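/- For a partition $\lambda=(\lambda_1,\dots,\lambda_l)$ of $n$, let $X_\lambda$ be the set of tuples $(X_1,\dots,X_l)$ of pairwise disjoint subsets of $\{1,\dots,n\}$ with $X_1\cup\cdots\cup X_l=\{1,\dots,n\}$ and $|X_i|=\lambda_i$ for all $i$. The symmetric group $S_n$ acts on $X_\lambda$ through its action on $\{1,\dots,n\}$, and hence on the space $\mathbf{C}[X_\lambda]$ of complex-valued functions on $X_\lambda$. A finite-dimensional complex representation $(\rho,V)$ of $S_n$ is called chiral if $\det\circ\rho$ is the sign character of $S_n$. Let $c(n)$ be the number of partitions $\lambda$ of $n$ for which $\mathbf{C}[X_\lambda]$ is chiral. Let $\nu(m)$ be the number of times $1$ occurs in the binary expansion of $m$, let $v_2(m)$ be the exponent of the largest power of $2$ dividing $m$, and let $B_m$ be the $m$th Bell number, i.e. the number of set partitions of an $m$-element set. Theorem. Let $n\ge 3$. If $n$ is even, then $$c(n)=\frac12\left(B_{\nu(n-2)+2}-B_{\nu(n-2)+1}+B_{\nu(n-2)}\right).$$ If $n$ is odd, with $v_2(n-1)=k$, then $$c(n)=\frac16\left(B_{\nu(n-3)+3}-3B_{\nu(n-3)+2}+5B_{\nu(n-3)+1}+2B_{\nu(n-3)}\right)+B_{\nu(n)+k-2}+B_{\nu(n)}-2B_{\nu(n)-1}.$$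 -/

import Mathlib

/-- A finite-dimensional complex representation `ρ` of the symmetric group `S_n` is chiral if
`det ∘ ρ` is the sign character of `S_n`. -/
def IsChiral {n : ℕ} {V : Type*} [AddCommGroup V] [Module ℂ V] [FiniteDimensional ℂ V]
    (ρ : Representation ℂ (Equiv.Perm (Fin n)) V) : Prop :=
  ∀ g : Equiv.Perm (Fin n), LinearMap.det (ρ g) = ((Equiv.Perm.sign g : ℤ) : ℂ)

/-- The parts `λ₁ ≥ λ₂ ≥ ⋯ ≥ λ_l` of a partition of `n`, as a weakly decreasing list. -/
def partList {n : ℕ} (lam : n.Partition) : List ℕ :=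
  lam.parts.sort (· ≥ ·)

/-- The set `X_λ` of tuples `(X₁, …, X_l)` of pairwise disjoint subsets of an `n`-element set
with union the whole set and with `|X_i| = λ_i` for every `i`. -/
def SetPartitionsOfShape {n : ℕ} (lam : n.Partition) : Type :=
  {X : Fin (partList lam).length → Finset (Fin n) //
    (∀ i j, i ≠ j → Disjoint (X i) (X j)) ∧
    (∀ a : Fin n, ∃ i, a ∈ X i) ∧
    ∀ i, (X i).card = (partList lam).get i}

instance {n : ℕ} (lam : n.Partition) : Finite (SetPartitionsOfShape lam) :=
  inferInstanceAs (Finite {X : Fin (partList lam).length → Finset (Fin n) //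
    (∀ i j, i ≠ j → Disjoint (X i) (X j)) ∧
    (∀ a : Fin n, ∃ i, a ∈ X i) ∧
    ∀ i, (X i).card = (partList lam).get i})

/-- `S_n` acts on `X_λ` by `g • (X₁, …, X_l) = (g(X₁), …, g(X_l))`. -/
instance {n : ℕ} (lam : n.Partition) :
    MulAction (Equiv.Perm (Fin n)) (SetPartitionsOfShape lam) where
  smul g X := ⟨fun i => (X.1 i).map g.toEmbedding, by
    refine ⟨fun i j hij => ?_, fun a => ?_, fun i => ?_⟩
    · exact (Finset.disjoint_map _).2 (X.2.1 i j hij)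
    · obtain ⟨i, hi⟩ := X.2.2.1 (g.symm a)
      exact ⟨i, Finset.mem_map.2 ⟨g.symm a, hi, g.apply_symm_apply a⟩⟩
    · rw [Finset.card_map]
      exact X.2.2.2 i⟩
  one_smul X := by
    apply Subtype.ext
    funext i
    exact Finset.map_refl
  mul_smul g h X := by
    apply Subtype.ext
    funext i
    change (X.1 i).map (g * h).toEmbedding = ((X.1 i).map h.toEmbedding).map g.toEmbedding
    rw [Finset.map_map]
    rfl

/-- The permutation representation `ℂ[X_λ]`: the space of complex-valued functions on `X_λ`, on
which `S_n` acts by `(g f)(X) = f(g⁻¹ • X)`. -/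
def permRep {n : ℕ} (lam : n.Partition) :
    Representation ℂ (Equiv.Perm (Fin n)) (SetPartitionsOfShape lam → ℂ) where
  toFun g := LinearMap.funLeft ℂ ℂ (fun X => g⁻¹ • X)
  map_one' := by
    ext f X
    simp [LinearMap.funLeft_apply]
  map_mul' g h := by
    ext f X
    simp [LinearMap.funLeft_apply, mul_smul]

/-- `c(n)`: the number of partitions `λ` of `n` such that `ℂ[X_λ]` is chiral. -/
noncomputable def numChiralPermReps (n : ℕ) : ℕ :=
  Nat.card {lam : n.Partition // IsChiral (permRep lam)}

/-- `ν(n)`: the number of times `1` occurs in the binary expansion of `n`. -/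
def binaryOnes (n : ℕ) : ℕ :=
  (Nat.digits 2 n).count 1

/-! Since `det ∘ ρ` takes values `±1`, chirality is decided by one transposition, say of `0` and
`1`. It acts on `X_λ` as an involution whose sign is `-1` to the number of tuples in which the block
of `0` precedes that of `1`. That number is the sum over `i < j` of the multinomial coefficients of
`λ - e_i - e_j`, and by Lucas such a coefficient is odd iff its entries have disjoint binary
expansions.

Let `r` be the number of odd parts and look at the lowest bit, which at most one entry of `λ - e_i -
e_j` may have. For `r = 0` no pair qualifies. For `r ≥ 2` only pairs of odd parts can, all with the
same condition: `r ≤ 3` and the halves of `λ` are bit-disjoint. As `r.choose 2` is odd for `r = 2,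
3`, that condition is chirality. For `r = 1`, with odd part `i` and halves `η`, the pairs are `{i,
k}` with `η - e_k` bit-disjoint; Pascal's rule, summing over all `k`, shows that chirality means
that exactly one of `η` and `η - e_i` is bit-disjoint (the latter requiring `η i ≥ 1`).

To count: bit-disjoint multisets of sum `N` are set partitions of the binary ones of `N`, and Bell
numbers are sums over them of polynomials in the number `p` of blocks. For `r = 2, 3` the sum is of
`∑ j ≤ r, p.choose j`, a combination of shifted Bell numbers (`sum_oddMarkedPartitions`). For `r =
1` it is the size of a symmetric difference, found by inclusion-exclusion
(`ncard_markedPairs_inter_raisedPairs`). -/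

/-! ### Bell numbers through an operator on block statistics. -/

/-- The operator `f ↦ (p ↦ p * f p + f (p + 1))`, which describes how a statistic of the number of
blocks changes when an element is added to a set partition. -/
def blockStep : Module.End ℚ (ℕ → ℚ) where
  toFun f p := p * f p + f (p + 1)
  map_add' f g := by ext p; simp; ring
  map_smul' c f := by ext p; simp; ring

lemma blockStep_apply (f : ℕ → ℚ) (p : ℕ) : blockStep f p = p * f p + f (p + 1) := rfl

/-- The shift operator on sequences. -/
def seqShift : Module.End ℚ (ℕ → ℚ) where
  toFun f p := f (p + 1)
  map_add' _ _ := rfl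
  map_smul' _ _ := rfl

lemma seqShift_apply (f : ℕ → ℚ) (p : ℕ) : seqShift f p = f (p + 1) := rfl

lemma seqShift_mul_blockStep_pow (n : ℕ) :
    seqShift * blockStep ^ n = (blockStep + 1) ^ n * seqShift := by
  have h : SemiconjBy seqShift blockStep (blockStep + 1) := by
    refine LinearMap.ext fun f => funext fun p => ?_
    simp only [Module.End.mul_apply, LinearMap.add_apply, Module.End.one_apply, Pi.add_apply,
      blockStep_apply, seqShift_apply]
    push_cast
    ring
  exact h.pow_right n

/-- A new element joins one of `p` blocks or opens a new one, so `(blockStep ^ n) 1 p` counts the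
extensions of a partition with `p` blocks by `n` elements. Moving the shift past `blockStep ^ n`
turns it into `(blockStep + 1) ^ n`, whose binomial expansion is the Bell recurrence. -/
theorem bell_eq_blockStep_pow (n : ℕ) : (Nat.bell n : ℚ) = (blockStep ^ n) 1 0 := by
  induction n using Nat.strong_induction_on with
  | _ n ih =>
    cases n with
    | zero => simp
    | succ n =>
      rw [Nat.bell_succ]
      have h1 : (blockStep ^ (n + 1)) 1 0 = (seqShift * blockStep ^ n) 1 0 := by
        rw [pow_succ', Module.End.mul_apply, Module.End.mul_apply, blockStep_apply, seqShift_apply]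
        simp
      have h2 : seqShift 1 = 1 := rfl
      rw [h1, seqShift_mul_blockStep_pow, Module.End.mul_apply, h2,
        (Commute.one_right blockStep).add_pow, ← Finset.sum_range_reflect]
      push_cast
      rw [← Nat.range_succ_eq_Iic]
      simp only [Finset.sum_apply]
      refine Finset.sum_congr rfl fun k hk => ?_
      have hk' : k ≤ n := by simpa [Nat.lt_succ_iff] using hk
      rw [Nat.choose_symm hk', Nat.sub_sub_self hk', ih (n - k) (by omega)]
      simp only [one_pow, mul_one]
      rw [← Nat.cast_comm (n.choose k), ← nsmul_eq_mul (n.choose k) (blockStep ^ (n - k)),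
        LinearMap.smul_apply, Pi.smul_apply, nsmul_eq_mul]

/-! ### Bit-disjoint multisets and the parity of multinomial coefficients. -/

/-- The members of `s` have pairwise disjoint binary expansions. -/
def BitDisjoint (s : Multiset ℕ) : Prop :=
  ∀ b, s.countP (fun x => x.testBit b) ≤ 1

lemma BitDisjoint.mono {s t : Multiset ℕ} (h : s ≤ t) (ht : BitDisjoint t) : BitDisjoint s :=
  fun b => (Multiset.countP_le_of_le _ h).trans (ht b)

lemma bitDisjoint_zero : BitDisjoint 0 := fun b => by simp

/-- Bit `0` is split off and the other bits are shifted down. Every induction on binary digits below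
rests on this. -/
lemma bitDisjoint_iff_half {s : Multiset ℕ} :
    BitDisjoint s ↔ s.countP Odd ≤ 1 ∧ BitDisjoint (s.map (· / 2)) := by
  have h0 : s.countP (fun x => x.testBit 0) = s.countP Odd :=
    Multiset.countP_congr rfl fun x _ => by simp [Nat.odd_iff]
  have h1 (b) : s.countP (fun x => x.testBit (b + 1)) =
      (s.map (· / 2)).countP (fun x => x.testBit b) := by
    rw [Multiset.countP_map, ← Multiset.countP_eq_card_filter]
    exact Multiset.countP_congr rfl fun x _ => by simp [Nat.testBit_succ]
  constructor
  · intro h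
    exact ⟨h0 ▸ h 0, fun b => h1 b ▸ h (b + 1)⟩
  · rintro ⟨h, h'⟩ (_ | b)
    · exact h0 ▸ h
    · exact h1 b ▸ h' b

lemma bitDisjoint_filter_ne_zero {s : Multiset ℕ} :
    BitDisjoint (s.filter (· ≠ 0)) ↔ BitDisjoint s := by
  refine forall_congr' fun b => ?_
  rw [Multiset.countP_filter]
  rw [Multiset.countP_congr rfl fun x _ => show (x.testBit b ∧ x ≠ 0) = (x.testBit b : Prop) from ?_]
  simp only [eq_iff_iff, and_iff_left_iff_imp]
  rintro h rfl
  simp at h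

lemma BitDisjoint.nodup {s : Multiset ℕ} (h : BitDisjoint s) (h0 : 0 ∉ s) : s.Nodup := by
  rw [Multiset.nodup_iff_le]
  intro a ha
  have ha0 : a ≠ 0 := by
    rintro rfl
    exact h0 (Multiset.subset_of_le ha (by simp))
  obtain ⟨b, hb⟩ := Nat.exists_testBit_of_ne_zero ha0
  have := h.mono ha b
  rw [Multiset.countP_cons, if_pos hb, Multiset.countP_cons, if_pos hb] at this
  omega

lemma sum_eq_two_mul_half_sum_add (s : Multiset ℕ) :
    s.sum = 2 * (s.map (· / 2)).sum + s.countP Odd := by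
  induction s using Multiset.induction_on with
  | empty => simp
  | cons a s ih =>
    rw [Multiset.sum_cons, Multiset.map_cons, Multiset.sum_cons, Multiset.countP_cons, ih]
    split_ifs with h
    · rw [Nat.odd_iff] at h; omega
    · rw [Nat.odd_iff] at h; omega

/-- Adding bit-disjoint numbers produces no carries. -/
lemma BitDisjoint.testBit_sum {s : Multiset ℕ} (h : BitDisjoint s) (b : ℕ) :
    s.sum.testBit b ↔ ∃ a ∈ s, a.testBit b := by
  induction b generalizing s with
  | zero =>
    have h1 := (bitDisjoint_iff_half.1 h).1
    have h2 : (∃ a ∈ s, a.testBit 0) ↔ 0 < s.countP Odd := by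
      rw [Multiset.countP_pos]; simp [Nat.odd_iff]
    have h3 := sum_eq_two_mul_half_sum_add s
    rw [h2]
    simp only [Nat.testBit_zero, decide_eq_true_eq]
    omega
  | succ b ih =>
    have h1 := bitDisjoint_iff_half.1 h
    have h3 := sum_eq_two_mul_half_sum_add s
    have h4 : s.sum / 2 = (s.map (· / 2)).sum := by omega
    rw [Nat.testBit_succ, h4, ih h1.2]
    simp [Nat.testBit_succ]

/-- Lucas' theorem modulo `2`, one digit at a time: the lowest factor vanishes exactly when both
last bits are `1`, the case of a carry. -/
lemma odd_choose_add_iff (a c : ℕ) :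
    Odd ((a + c).choose a) ↔ ∀ b, ¬ (a.testBit b ∧ c.testBit b) := by
  induction a using Nat.strong_induction_on generalizing c with
  | _ a ih =>
    rcases Nat.eq_zero_or_pos a with rfl | ha
    · simp
    have hl : (a + c).choose a ≡ _ [MOD 2] := Choose.choose_modEq_choose_mod_mul_choose_div_nat
    have hodd : Odd ((a + c).choose a) ↔
        Odd (((a + c) % 2).choose (a % 2) * ((a + c) / 2).choose (a / 2)) := by
      rw [Nat.odd_iff, Nat.odd_iff, hl]
    rw [hodd, Nat.odd_mul]
    have hb : (∀ b, ¬ (a.testBit b ∧ c.testBit b)) ↔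
        ¬ (a % 2 = 1 ∧ c % 2 = 1) ∧ ∀ b, ¬ ((a / 2).testBit b ∧ (c / 2).testBit b) := by
      constructor
      · intro h
        exact ⟨by simpa using h 0, fun b => by simpa [Nat.testBit_succ] using h (b + 1)⟩
      · rintro ⟨h, h'⟩ (_ | b)
        · simpa using h
        · simpa [Nat.testBit_succ] using h' b
    rw [hb, ← ih (a / 2) (by omega)]
    rcases Nat.mod_two_eq_zero_or_one a with h1 | h1 <;>
      rcases Nat.mod_two_eq_zero_or_one c with h2 | h2
    · have e1 : (a + c) % 2 = 0 := by omega
      have e2 : (a + c) / 2 = a / 2 + c / 2 := by omega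
      simp [h1, h2, e1, e2]
    · have e1 : (a + c) % 2 = 1 := by omega
      have e2 : (a + c) / 2 = a / 2 + c / 2 := by omega
      simp [h1, h2, e1, e2]
    · have e1 : (a + c) % 2 = 1 := by omega
      have e2 : (a + c) / 2 = a / 2 + c / 2 := by omega
      simp [h1, h2, e1, e2]
    · have e1 : (a + c) % 2 = 0 := by omega
      simp [h1, h2, e1]

theorem odd_multinomial_iff (s : Multiset ℕ) : Odd s.multinomial ↔ BitDisjoint s := by
  induction s using Multiset.induction_on with
  | empty => simp [bitDisjoint_zero]
  | cons a s ih =>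
    rw [Multiset.multinomial_cons, Nat.odd_mul, ih, odd_choose_add_iff]
    constructor
    · rintro ⟨h1, h2⟩ b
      rw [Multiset.countP_cons]
      split_ifs with hb
      · have h3 := h1 b
        rw [h2.testBit_sum] at h3
        have : s.countP (fun x => x.testBit b) = 0 := by
          rw [Multiset.countP_eq_zero]
          intro x hx hxb
          exact h3 ⟨hb, x, hx, hxb⟩
        omega
      · exact h2 b
    · intro h
      have h2 : BitDisjoint s := h.mono (Multiset.le_cons_self s a)
      refine ⟨fun b hb => ?_, h2⟩
      rw [h2.testBit_sum] at hb
      obtain ⟨hab, x, hx, hxb⟩ := hb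
      have h3 := h b
      rw [Multiset.countP_cons, if_pos hab] at h3
      have : 0 < s.countP (fun x => x.testBit b) := Multiset.countP_pos.2 ⟨x, hx, hxb⟩
      omega

/-! ### Multisets with a given number of odd members and bit-disjoint halves. -/

open Classical in
/-- The multisets of positive integers with sum `N` and with pairwise disjoint binary expansions. -/
noncomputable def binaryPartitions (N : ℕ) : Finset (Multiset ℕ) :=
  (Finset.univ.image (fun p : N.Partition => p.parts)).filter BitDisjoint

open Classical in
/-- The multisets of positive integers with exactly `r` odd members whose halves, rounded down,
have sum `M` and pairwise disjoint binary expansions. -/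
noncomputable def oddMarkedPartitions (r M : ℕ) : Finset (Multiset ℕ) :=
  (Finset.univ.image (fun p : (2 * M + r).Partition => p.parts)).filter
    fun s => s.countP Odd = r ∧ BitDisjoint (s.map (· / 2))

lemma mem_image_parts {N : ℕ} {s : Multiset ℕ} :
    s ∈ Finset.univ.image (fun p : N.Partition => p.parts) ↔ 0 ∉ s ∧ s.sum = N := by
  simp only [Finset.mem_image, Finset.mem_univ, true_and]
  constructor
  · rintro ⟨p, rfl⟩
    exact ⟨fun h => (p.parts_pos h).ne' rfl, p.parts_sum⟩
  · rintro ⟨h0, hs⟩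
    exact ⟨⟨s, fun {i} hi => Nat.pos_of_ne_zero fun h => h0 (h ▸ hi), hs⟩, rfl⟩

lemma mem_binaryPartitions {N : ℕ} {s : Multiset ℕ} :
    s ∈ binaryPartitions N ↔ 0 ∉ s ∧ s.sum = N ∧ BitDisjoint s := by
  classical
  rw [binaryPartitions, Finset.mem_filter, mem_image_parts, and_assoc]

lemma mem_oddMarkedPartitions {r M : ℕ} {s : Multiset ℕ} :
    s ∈ oddMarkedPartitions r M ↔
      0 ∉ s ∧ s.countP Odd = r ∧ (s.map (· / 2)).sum = M ∧ BitDisjoint (s.map (· / 2)) := by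
  classical
  rw [oddMarkedPartitions, Finset.mem_filter, mem_image_parts]
  have := sum_eq_two_mul_half_sum_add s
  constructor
  · rintro ⟨⟨h0, hs⟩, hc, hb⟩
    exact ⟨h0, hc, by omega, hb⟩
  · rintro ⟨h0, hc, hs, hb⟩
    exact ⟨⟨h0, by omega⟩, hc, hb⟩

lemma binaryPartitions_two_mul (M : ℕ) : binaryPartitions (2 * M) = oddMarkedPartitions 0 M := by
  ext s
  rw [mem_binaryPartitions, mem_oddMarkedPartitions, bitDisjoint_iff_half]
  have := sum_eq_two_mul_half_sum_add s
  constructor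
  · rintro ⟨h0, hs, hc, hb⟩
    exact ⟨h0, by omega, by omega, hb⟩
  · rintro ⟨h0, hc, hs, hb⟩
    exact ⟨h0, by omega, by omega, hb⟩

lemma binaryPartitions_two_mul_add_one (M : ℕ) :
    binaryPartitions (2 * M + 1) = oddMarkedPartitions 1 M := by
  ext s
  rw [mem_binaryPartitions, mem_oddMarkedPartitions, bitDisjoint_iff_half]
  have := sum_eq_two_mul_half_sum_add s
  constructor
  · rintro ⟨h0, hs, hc, hb⟩
    exact ⟨h0, by omega, by omega, hb⟩
  · rintro ⟨h0, hc, hs, hb⟩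
    exact ⟨h0, by omega, by omega, hb⟩

lemma map_half_map_odd (Q : Multiset ℕ) : (Q.map (fun x => 2 * x + 1)).map (· / 2) = Q := by
  rw [Multiset.map_map]
  conv_rhs => rw [← Multiset.map_id Q]
  refine Multiset.map_congr rfl fun x _ => ?_
  simp only [Function.comp, id]
  omega

lemma map_half_map_even (Q : Multiset ℕ) : (Q.map (fun x => 2 * x)).map (· / 2) = Q := by
  rw [Multiset.map_map]
  conv_rhs => rw [← Multiset.map_id Q]
  refine Multiset.map_congr rfl fun x _ => ?_
  simp only [Function.comp, id]
  omega

lemma map_odd_map_half {Q : Multiset ℕ} (h : ∀ x ∈ Q, Odd x) :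
    (Q.map (· / 2)).map (fun x => 2 * x + 1) = Q := by
  rw [Multiset.map_map]
  conv_rhs => rw [← Multiset.map_id Q]
  refine Multiset.map_congr rfl fun x hx => ?_
  have := Nat.odd_iff.1 (h x hx)
  simp only [Function.comp, id]
  omega

lemma map_even_map_half {Q : Multiset ℕ} (h : ∀ x ∈ Q, ¬ Odd x) :
    (Q.map (· / 2)).map (fun x => 2 * x) = Q := by
  rw [Multiset.map_map]
  conv_rhs => rw [← Multiset.map_id Q]
  refine Multiset.map_congr rfl fun x hx => ?_
  have := Nat.not_odd_iff.1 (h x hx)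
  simp only [Function.comp, id]
  omega

lemma filter_odd_odd_add_even (Q T : Multiset ℕ) :
    (Q.map (fun x => 2 * x + 1) + T.map (fun x => 2 * x)).filter Odd =
      Q.map (fun x => 2 * x + 1) := by
  rw [Multiset.filter_add, Multiset.filter_eq_self.2, Multiset.filter_eq_nil.2, add_zero]
  · simp
  · simp

lemma filter_not_odd_odd_add_even (Q T : Multiset ℕ) :
    (Q.map (fun x => 2 * x + 1) + T.map (fun x => 2 * x)).filter (fun x => ¬ Odd x) =
      T.map (fun x => 2 * x) := by
  rw [Multiset.filter_add, Multiset.filter_eq_nil.2, zero_add, Multiset.filter_eq_self]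
  · simp
  · simp

lemma eq_odd_add_even (s : Multiset ℕ) :
    ((s.filter Odd).map (· / 2)).map (fun x => 2 * x + 1) +
      ((s.filter (fun x => ¬ Odd x)).map (· / 2)).map (fun x => 2 * x) = s := by
  rw [map_odd_map_half (by simp), map_even_map_half (by simp), Multiset.filter_add_not]

lemma filter_ne_zero_add_replicate (s : Multiset ℕ) :
    s.filter (· ≠ 0) + Multiset.replicate (s.card - (s.filter (· ≠ 0)).card) 0 = s := by
  have h1 := Multiset.filter_add_not (· ≠ 0) s
  have h2 : s.filter (fun x => ¬ x ≠ 0) = Multiset.replicate (s.count 0) 0 := by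
    simp [Multiset.filter_eq']
  have h3 := congrArg Multiset.card h1
  rw [Multiset.card_add, h2, Multiset.card_replicate] at h3
  rw [← h3, Nat.add_sub_cancel_left, ← h2, h1]

lemma half_odd_add_even {P Q : Multiset ℕ} (hQ : Q ≤ P) (k : ℕ) :
    ((Q + Multiset.replicate k 0).map (fun x => 2 * x + 1) +
      (P - Q).map (fun x => 2 * x)).map (· / 2) = P + Multiset.replicate k 0 := by
  rw [Multiset.map_add, map_half_map_odd, map_half_map_even, add_right_comm,
    add_tsub_cancel_of_le hQ]

lemma filter_ne_zero_of_notMem {P : Multiset ℕ} (h0 : 0 ∉ P) (k : ℕ) :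
    (P + Multiset.replicate k 0).filter (· ≠ 0) = P := by
  have h1 : (Multiset.replicate k 0).filter (· ≠ 0) = 0 :=
    Multiset.filter_eq_nil.2 fun a ha => by simpa using (Multiset.mem_replicate.1 ha).2
  rw [Multiset.filter_add, h1, add_zero, Multiset.filter_eq_self]
  rintro a ha rfl
  exact h0 ha

lemma filter_half_eq {s : Multiset ℕ} (h0 : 0 ∉ s) :
    (s.map (· / 2)).filter (· ≠ 0) =
      ((s.filter Odd).map (· / 2)).filter (· ≠ 0) + (s.filter (fun x => ¬ Odd x)).map (· / 2) := by
  conv_lhs => rw [← Multiset.filter_add_not Odd s, Multiset.map_add, Multiset.filter_add]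
  congr 1
  rw [Multiset.filter_eq_self]
  intro a ha
  obtain ⟨x, hx, rfl⟩ := Multiset.mem_map.1 ha
  obtain ⟨hx, hx'⟩ := Multiset.mem_filter.1 hx
  have : x ≠ 0 := fun h => h0 (h ▸ hx)
  rw [Nat.not_odd_iff] at hx'
  omega

lemma card_toFinset_powersetCard {P : Multiset ℕ} (hP : P.Nodup) (j : ℕ) :
    (P.powersetCard j).toFinset.card = P.card.choose j := by
  rw [Multiset.toFinset_card_of_nodup (hP.powersetCard), Multiset.card_powersetCard]

/-- A multiset with `r` odd members is determined by its nonzero halves and the submultiset of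
those which come from odd members. -/
theorem sum_oddMarkedPartitions (r M : ℕ) (f : ℕ → ℚ) :
    ∑ s ∈ oddMarkedPartitions r M, f s.card =
      ∑ P ∈ binaryPartitions M, ∑ j ∈ Finset.range (r + 1),
        (P.card.choose j : ℚ) * f (P.card + (r - j)) := by
  have key : ∑ s ∈ oddMarkedPartitions r M, f s.card =
      ∑ x ∈ (binaryPartitions M).sigma fun P => (Finset.range (r + 1)).sigma fun j =>
        (P.powersetCard j).toFinset, f (x.1.card + (r - x.2.1)) := by
    -- `P` holds the nonzero halves and `Q ≤ P` those from odd members, `j` in number. The other `r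
    -- - j` odd members equal `1`: their half `0` is lost in `P` and restored by `replicate`.
    refine Finset.sum_bij'
      (i := fun s _ => ⟨(s.map (· / 2)).filter (· ≠ 0),
        (((s.filter Odd).map (· / 2)).filter (· ≠ 0)).card,
        ((s.filter Odd).map (· / 2)).filter (· ≠ 0)⟩)
      (j := fun x _ => (x.2.2 + Multiset.replicate (r - x.2.1) 0).map (fun x => 2 * x + 1) +
        (x.1 - x.2.2).map (fun x => 2 * x)) ?_ ?_ ?_ ?_ ?_
    · intro s hs
      rw [mem_oddMarkedPartitions] at hs
      obtain ⟨h0, hc, hsum, hb⟩ := hs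
      simp only [Finset.mem_sigma, mem_binaryPartitions, Finset.mem_range, Multiset.mem_toFinset,
        Multiset.mem_powersetCard, and_true]
      refine ⟨⟨by simp, ?_, bitDisjoint_filter_ne_zero.2 hb⟩, ?_, ?_⟩
      · rw [← hsum]
        conv_rhs => rw [← Multiset.filter_add_not (· ≠ 0) (s.map (· / 2)), Multiset.sum_add]
        simp [Multiset.filter_eq']
      · rw [Nat.lt_succ_iff, ← hc, Multiset.countP_eq_card_filter]
        exact (Multiset.card_le_card (Multiset.filter_le _ _)).trans (by simp)
      · exact Multiset.filter_le_filter _ (Multiset.map_le_map (Multiset.filter_le _ _))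
    · rintro ⟨P, j, Q⟩ hx
      simp only [Finset.mem_sigma, mem_binaryPartitions, Finset.mem_range, Multiset.mem_toFinset,
        Multiset.mem_powersetCard] at hx
      obtain ⟨⟨h0, hsum, hb⟩, hj, hQ, hc⟩ := hx
      rw [mem_oddMarkedPartitions]
      refine ⟨?_, ?_, ?_, ?_⟩
      · simp only [Multiset.mem_add, Multiset.mem_map, not_or, not_exists, not_and]
        refine ⟨fun x _ => by omega, fun x hx => ?_⟩
        have : x ≠ 0 := by
          rintro rfl
          exact h0 (Multiset.subset_of_le tsub_le_self hx)
        omega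
      · rw [Multiset.countP_eq_card_filter, filter_odd_odd_add_even]
        simp [hc]; omega
      · rw [half_odd_add_even hQ]; simp [hsum]
      · rwa [half_odd_add_even hQ, ← bitDisjoint_filter_ne_zero, filter_ne_zero_of_notMem h0]
    · intro s hs
      rw [mem_oddMarkedPartitions] at hs
      obtain ⟨h0, hc, hsum, hb⟩ := hs
      have hcard : ((s.filter Odd).map (· / 2)).card = r := by
        rw [Multiset.card_map, ← Multiset.countP_eq_card_filter, hc]
      have h1 := filter_ne_zero_add_replicate ((s.filter Odd).map (· / 2))
      rw [hcard] at h1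
      have h2 := filter_half_eq h0
      dsimp only
      rw [h1, h2, add_tsub_cancel_left]
      exact eq_odd_add_even s
    · rintro ⟨P, j, Q⟩ hx
      simp only [Finset.mem_sigma, mem_binaryPartitions, Finset.mem_range, Multiset.mem_toFinset,
        Multiset.mem_powersetCard] at hx
      obtain ⟨⟨h0, hsum, hb⟩, hj, hQ, rfl⟩ := hx
      dsimp only
      rw [half_odd_add_even hQ, filter_odd_odd_add_even, map_half_map_odd,
        filter_ne_zero_of_notMem h0,
        filter_ne_zero_of_notMem fun h => h0 (Multiset.subset_of_le hQ h)]
    · intro s hs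
      rw [mem_oddMarkedPartitions] at hs
      obtain ⟨h0, hc, hsum, hb⟩ := hs
      have h2 := filter_half_eq h0
      have hcard : (s.filter Odd).card = r := by rw [← Multiset.countP_eq_card_filter, hc]
      have h3 := congrArg Multiset.card (Multiset.filter_add_not Odd s)
      have h4 : (((s.filter Odd).map (· / 2)).filter (· ≠ 0)).card ≤ r := by
        rw [← hcard]
        exact (Multiset.card_le_card (Multiset.filter_le _ _)).trans (by simp)
      dsimp only
      rw [h2, Multiset.card_add, Multiset.card_map]
      rw [Multiset.card_add] at h3
      congr 1
      omega
  rw [key, Finset.sum_sigma]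
  refine Finset.sum_congr rfl fun P hP => ?_
  rw [mem_binaryPartitions] at hP
  rw [Finset.sum_sigma]
  refine Finset.sum_congr rfl fun j _ => ?_
  dsimp only
  -- The factor `p.choose j` needs `P` without repetition: bit-disjoint positive members are
  -- distinct.
  rw [Finset.sum_const, card_toFinset_powersetCard (hP.2.2.nodup hP.1), nsmul_eq_mul]

/-! ### Binary digit sums and Bell-number counts. -/

lemma binaryOnes_zero : binaryOnes 0 = 0 := by simp [binaryOnes]

lemma binaryOnes_two_mul (M : ℕ) : binaryOnes (2 * M) = binaryOnes M := by
  rcases Nat.eq_zero_or_pos M with rfl | hM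
  · simp
  · have := Nat.digits_def' (b := 2) (by norm_num) (n := 2 * M) (by omega)
    rw [binaryOnes, this]
    simp [binaryOnes]

lemma binaryOnes_two_mul_add_one (M : ℕ) : binaryOnes (2 * M + 1) = binaryOnes M + 1 := by
  have := Nat.digits_def' (b := 2) (by norm_num) (n := 2 * M + 1) (by omega)
  have h2 : (2 * M + 1) / 2 = M := by omega
  have h3 : (2 * M + 1) % 2 = 1 := by omega
  rw [binaryOnes, this, h2, h3]
  simp [binaryOnes]

/-- Adding `1` to `M` turns its trailing ones, `v₂(M + 1)` in number, into zeros and the next zero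
into a one. -/
lemma binaryOnes_succ_add_padicValNat (M : ℕ) :
    binaryOnes (M + 1) + padicValNat 2 (M + 1) = binaryOnes M + 1 := by
  induction M using Nat.strong_induction_on with
  | _ M ih =>
    obtain ⟨m, rfl | rfl⟩ := Nat.even_or_odd' M
    · rw [binaryOnes_two_mul_add_one, binaryOnes_two_mul,
        padicValNat.eq_zero_of_not_dvd (by omega)]
    · have h := ih m (by omega)
      have e : 2 * m + 1 + 1 = 2 * (m + 1) := by ring
      rw [e, binaryOnes_two_mul, binaryOnes_two_mul_add_one,
        padicValNat.mul (by norm_num) (by omega), padicValNat.self (by norm_num)]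
      omega

/-- Induction on the binary digits of `N`: a last digit `0` changes nothing, while a last digit `1`
makes one of the `p` halves odd or adds a part `1`, which is `blockStep`. -/
theorem sum_binaryPartitions (N : ℕ) (f : ℕ → ℚ) :
    ∑ s ∈ binaryPartitions N, f s.card = (blockStep ^ binaryOnes N) f 0 := by
  induction N using Nat.strong_induction_on generalizing f with
  | _ N ih =>
    obtain ⟨m, rfl | rfl⟩ := Nat.even_or_odd' N
    · rcases Nat.eq_zero_or_pos m with rfl | hm
      · have : binaryPartitions (2 * 0) = {0} := by
          ext s
          rw [mem_binaryPartitions, Finset.mem_singleton]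
          constructor
          · rintro ⟨h0, hs, -⟩
            rw [Multiset.eq_zero_iff_forall_notMem]
            intro a ha
            rw [Multiset.sum_eq_zero_iff.1 hs a ha] at ha
            exact h0 ha
          · rintro rfl
            exact ⟨by simp, by simp, bitDisjoint_zero⟩
        rw [this]
        simp [binaryOnes_zero]
      · rw [binaryPartitions_two_mul, binaryOnes_two_mul, ← ih m (by omega),
          sum_oddMarkedPartitions]
        simp
    · rw [binaryPartitions_two_mul_add_one, binaryOnes_two_mul_add_one, pow_succ,
        Module.End.mul_apply, ← ih m (by omega), sum_oddMarkedPartitions]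
      refine Finset.sum_congr rfl fun P _ => ?_
      rw [Finset.sum_range_succ, Finset.sum_range_one, blockStep_apply]
      simp [add_comm]

theorem bell_binaryOnes_add (N j : ℕ) :
    (Nat.bell (binaryOnes N + j) : ℚ) =
      ∑ s ∈ binaryPartitions N, (blockStep ^ j) 1 s.card := by
  rw [sum_binaryPartitions, bell_eq_blockStep_pow, pow_add, Module.End.mul_apply]

theorem card_binaryPartitions (N : ℕ) :
    (binaryPartitions N).card = Nat.bell (binaryOnes N) := by
  have h := bell_binaryOnes_add N 0
  rw [add_zero] at h
  have : ((binaryPartitions N).card : ℚ) = Nat.bell (binaryOnes N) := by rw [h]; simp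
  exact_mod_cast this

theorem card_oddMarkedPartitions_one (M : ℕ) :
    (oddMarkedPartitions 1 M).card = Nat.bell (binaryOnes M + 1) := by
  rw [← binaryPartitions_two_mul_add_one, card_binaryPartitions, binaryOnes_two_mul_add_one]

lemma cast_card_oddMarkedPartitions (r M : ℕ) :
    ((oddMarkedPartitions r M).card : ℚ) =
      ∑ P ∈ binaryPartitions M, ∑ j ∈ Finset.range (r + 1), (P.card.choose j : ℚ) := by
  have h := sum_oddMarkedPartitions r M 1
  simpa using h

/-- Termwise identity of polynomials in `p`: the Bell numbers with shifts `0, 1, 2` sum `1`, `p +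
1`, `p² + 2p + 2`, which combine to `1 + p + p.choose 2`. -/
theorem cast_card_oddMarkedPartitions_two (M : ℕ) :
    ((oddMarkedPartitions 2 M).card : ℚ) =
      1 / 2 * ((Nat.bell (binaryOnes M + 2) : ℚ) - Nat.bell (binaryOnes M + 1)
        + Nat.bell (binaryOnes M)) := by
  have h0 := bell_binaryOnes_add M 0
  rw [add_zero] at h0
  rw [cast_card_oddMarkedPartitions, h0, bell_binaryOnes_add M 1, bell_binaryOnes_add M 2,
    ← Finset.sum_sub_distrib, ← Finset.sum_add_distrib, Finset.mul_sum]
  refine Finset.sum_congr rfl fun P _ => ?_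
  simp only [Finset.sum_range_succ, Finset.sum_range_zero, pow_succ, pow_zero, one_mul,
    Module.End.mul_apply, Module.End.one_apply, blockStep_apply, Nat.cast_choose_two,
    Nat.choose_zero_right, Nat.choose_one_right, Pi.one_apply]
  push_cast
  ring

lemma cast_choose_three (p : ℕ) : (p.choose 3 : ℚ) = p * (p - 1) * (p - 2) / 6 := by
  rw [Nat.cast_choose_eq_ascPochhammer_div]
  simp [ascPochhammer_succ_right, Nat.factorial]
  -- `p - 2` is a truncated subtraction here, so `p = 0, 1` are treated apart.
  rcases p with _ | _ | p
  · simp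
  · simp
  · push_cast [show p + 1 + 1 - 2 = p by omega]
    ring

theorem cast_card_oddMarkedPartitions_three (M : ℕ) :
    ((oddMarkedPartitions 3 M).card : ℚ) =
      1 / 6 * ((Nat.bell (binaryOnes M + 3) : ℚ) - 3 * Nat.bell (binaryOnes M + 2)
        + 5 * Nat.bell (binaryOnes M + 1) + 2 * Nat.bell (binaryOnes M)) := by
  have h0 := bell_binaryOnes_add M 0
  rw [add_zero] at h0
  rw [cast_card_oddMarkedPartitions, h0, bell_binaryOnes_add M 1, bell_binaryOnes_add M 2,
    bell_binaryOnes_add M 3, Finset.mul_sum, Finset.mul_sum, Finset.mul_sum,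
    ← Finset.sum_sub_distrib, ← Finset.sum_add_distrib, ← Finset.sum_add_distrib, Finset.mul_sum]
  refine Finset.sum_congr rfl fun P _ => ?_
  simp only [Finset.sum_range_succ, Finset.sum_range_zero, pow_succ, pow_zero, one_mul,
    Module.End.mul_apply, Module.End.one_apply, blockStep_apply, Nat.cast_choose_two,
    Nat.choose_zero_right, Nat.choose_one_right, Pi.one_apply, cast_choose_three]
  push_cast
  ring

/-! ### Marked pairs, for partitions with exactly one odd part. -/

/-- The binary partitions of `N` with one marked part, which may be zero. -/
def markedPairs (N : ℕ) : Set (ℕ × Multiset ℕ) :=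
  {x | 0 ∉ x.2 ∧ x.1 + x.2.sum = N ∧ BitDisjoint (x.1 ::ₘ x.2)}

/-- The pairs `(a, t)` with `a` positive such that `(a - 1, t)` is a marked binary partition
of `N - 1`. -/
def raisedPairs (N : ℕ) : Set (ℕ × Multiset ℕ) :=
  {x | 0 ∉ x.2 ∧ x.1 + x.2.sum = N ∧ 1 ≤ x.1 ∧ BitDisjoint ((x.1 - 1) ::ₘ x.2)}

/-- The multiset with one odd member whose half is `x.1` and with even members `2 * b` for `b` in
`x.2`. -/
def oddConsEven (x : ℕ × Multiset ℕ) : Multiset ℕ :=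
  (2 * x.1 + 1) ::ₘ x.2.map (fun b => 2 * b)

lemma oddConsEven_injective : Function.Injective oddConsEven := by
  rintro ⟨a, t⟩ ⟨b, u⟩ h
  have e : ∀ x : ℕ × Multiset ℕ, oddConsEven x =
      ({x.1} : Multiset ℕ).map (fun x => 2 * x + 1) + x.2.map (fun x => 2 * x) := fun x => by
    simp [oddConsEven]
  rw [e, e] at h
  have h1 := congrArg (fun s => (s.filter Odd).map (· / 2)) h
  have h2 := congrArg (fun s => (s.filter (fun x => ¬ Odd x)).map (· / 2)) h
  simp only [filter_odd_odd_add_even, map_half_map_odd] at h1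
  simp only [filter_not_odd_odd_add_even, map_half_map_even] at h2
  simp only [Multiset.singleton_inj] at h1
  rw [h1, h2]

lemma exists_oddConsEven {s : Multiset ℕ} (h : s.countP Odd = 1) : ∃ x, s = oddConsEven x := by
  rw [Multiset.countP_eq_card_filter, Multiset.card_eq_one] at h
  obtain ⟨a, ha⟩ := h
  have h1 := eq_odd_add_even s
  rw [ha] at h1
  exact ⟨(a / 2, (s.filter (fun x => ¬ Odd x)).map (· / 2)), by
    rw [oddConsEven]; simpa using h1.symm⟩

lemma countP_odd_oddConsEven (x : ℕ × Multiset ℕ) : (oddConsEven x).countP Odd = 1 := by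
  rw [oddConsEven, Multiset.countP_cons, if_pos ⟨x.1, rfl⟩, Multiset.countP_eq_zero.2]
  simp

lemma half_oddConsEven (x : ℕ × Multiset ℕ) : (oddConsEven x).map (· / 2) = x.1 ::ₘ x.2 := by
  rw [oddConsEven, Multiset.map_cons, map_half_map_even]
  congr 1
  omega

lemma zero_mem_oddConsEven (x : ℕ × Multiset ℕ) : 0 ∈ oddConsEven x ↔ 0 ∈ x.2 := by
  simp [oddConsEven]

lemma image_markedPairs (N : ℕ) : oddConsEven '' markedPairs N = oddMarkedPartitions 1 N := by
  ext s
  simp only [Set.mem_image, Finset.mem_coe, mem_oddMarkedPartitions]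
  constructor
  · rintro ⟨x, hx, rfl⟩
    rw [zero_mem_oddConsEven, countP_odd_oddConsEven, half_oddConsEven, Multiset.sum_cons]
    exact ⟨hx.1, rfl, hx.2⟩
  · rintro ⟨h0, hc, hs⟩
    obtain ⟨x, rfl⟩ := exists_oddConsEven hc
    rw [half_oddConsEven, Multiset.sum_cons] at hs
    exact ⟨x, ⟨by rwa [zero_mem_oddConsEven] at h0, hs⟩, rfl⟩

lemma finite_markedPairs (N : ℕ) : (markedPairs N).Finite := by
  refine Set.Finite.of_finite_image ?_ oddConsEven_injective.injOn
  rw [image_markedPairs]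
  exact Finset.finite_toSet _

lemma ncard_markedPairs (N : ℕ) : (markedPairs N).ncard = Nat.bell (binaryOnes N + 1) := by
  rw [← Set.ncard_image_of_injective _ oddConsEven_injective, image_markedPairs,
    Set.ncard_coe_finset, card_oddMarkedPartitions_one]

lemma raisedPairs_succ (N : ℕ) :
    raisedPairs (N + 1) = (fun x : ℕ × Multiset ℕ => (x.1 + 1, x.2)) '' markedPairs N := by
  ext ⟨a, t⟩
  simp only [raisedPairs, markedPairs, Set.mem_ofPred_eq, Set.mem_image, Prod.exists, Prod.mk.injEq]
  constructor
  · rintro ⟨h0, hs, ha, hb⟩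
    exact ⟨a - 1, t, ⟨h0, by omega, hb⟩, by omega, rfl⟩
  · rintro ⟨a, t, ⟨h0, hs, hb⟩, rfl, rfl⟩
    exact ⟨h0, by omega, by omega, hb⟩

lemma raise_injective : Function.Injective (fun x : ℕ × Multiset ℕ => (x.1 + 1, x.2)) := by
  rintro ⟨a, t⟩ ⟨b, u⟩ h
  simpa using h

lemma ncard_raisedPairs_succ (N : ℕ) :
    (raisedPairs (N + 1)).ncard = Nat.bell (binaryOnes N + 1) := by
  rw [raisedPairs_succ, Set.ncard_image_of_injective _ raise_injective, ncard_markedPairs]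

lemma finite_raisedPairs_succ (N : ℕ) : (raisedPairs (N + 1)).Finite := by
  rw [raisedPairs_succ]
  exact (finite_markedPairs N).image _

lemma countP_odd_map_two_mul (t : Multiset ℕ) : (t.map (fun b => 2 * b)).countP Odd = 0 := by
  rw [Multiset.countP_eq_zero]; simp

/-- If `a` were odd, bit-disjointness would leave no odd member in `t` and the total would be odd.
So `a` is even, parity makes all of `t` even, and halving turns `a - 1` into `a / 2 - 1`. -/
lemma inter_two_mul {N : ℕ} :
    markedPairs (2 * N) ∩ raisedPairs (2 * N) =
      (fun x : ℕ × Multiset ℕ => (2 * x.1, x.2.map (fun b => 2 * b))) ''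
        (markedPairs N ∩ raisedPairs N) := by
  ext ⟨a, t⟩
  simp only [raisedPairs, markedPairs, Set.mem_inter_iff, Set.mem_ofPred_eq, Set.mem_image,
    Prod.exists, Prod.mk.injEq]
  constructor
  · rintro ⟨⟨h0, hs, hb⟩, -, -, ha, hb'⟩
    have h2 := sum_eq_two_mul_half_sum_add t
    rw [bitDisjoint_iff_half, Multiset.countP_cons, Multiset.map_cons] at hb
    rw [bitDisjoint_iff_half, Multiset.countP_cons, Multiset.map_cons] at hb'
    have hae : ¬ Odd a := by
      intro h
      have hb1 := hb.1
      rw [if_pos h] at hb1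
      rw [Nat.odd_iff] at h
      omega
    have hb1 := hb.1
    rw [if_neg hae] at hb1
    rw [Nat.not_odd_iff] at hae
    have ht : t.countP Odd = 0 := by omega
    have ht' : (t.map (· / 2)).map (fun b => 2 * b) = t :=
      map_even_map_half (Multiset.countP_eq_zero.1 ht)
    have h00 : 0 ∉ t.map (· / 2) := by
      intro h
      apply h0
      rw [← ht']
      exact Multiset.mem_map.2 ⟨0, h, rfl⟩
    have e : (a - 1) / 2 = a / 2 - 1 := by omega
    rw [e] at hb'
    exact ⟨a / 2, t.map (· / 2), ⟨⟨h00, by omega, hb.2⟩, h00, by omega, by omega, hb'.2⟩,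
      by omega, ht'⟩
  · rintro ⟨a, t, ⟨⟨h0, hs, hb⟩, -, -, ha, hb'⟩, rfl, rfl⟩
    have hsum : (t.map (fun b => 2 * b)).sum = 2 * t.sum := by rw [Multiset.sum_map_mul_left]; simp
    have h00 : 0 ∉ t.map (fun b => 2 * b) := by simpa using h0
    have e1 : 2 * a / 2 = a := by omega
    have e2 : (2 * a - 1) / 2 = a - 1 := by omega
    rw [bitDisjoint_iff_half (s := 2 * a ::ₘ _), bitDisjoint_iff_half (s := (2 * a - 1) ::ₘ _),
      Multiset.countP_cons, Multiset.countP_cons, Multiset.map_cons, Multiset.map_cons,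
      map_half_map_even, countP_odd_map_two_mul, e1, e2, hsum]
    refine ⟨⟨h00, by omega, ?_, hb⟩, h00, by omega, by omega, ?_, hb'⟩ <;> split_ifs <;> simp

/-- If `a` were even, `t` would have an odd member, clashing with the odd `a - 1`. So `a` is odd and
`t` even; then `a` and `a - 1` have the same half, and the second condition becomes redundant. -/
lemma inter_two_mul_add_one {N : ℕ} :
    markedPairs (2 * N + 1) ∩ raisedPairs (2 * N + 1) =
      (fun x : ℕ × Multiset ℕ => (2 * x.1 + 1, x.2.map (fun b => 2 * b))) '' markedPairs N := by
  ext ⟨a, t⟩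
  simp only [raisedPairs, markedPairs, Set.mem_inter_iff, Set.mem_ofPred_eq, Set.mem_image,
    Prod.exists, Prod.mk.injEq]
  constructor
  · rintro ⟨⟨h0, hs, hb⟩, -, -, ha, hb'⟩
    have h2 := sum_eq_two_mul_half_sum_add t
    rw [bitDisjoint_iff_half, Multiset.countP_cons, Multiset.map_cons] at hb
    rw [bitDisjoint_iff_half, Multiset.countP_cons, Multiset.map_cons] at hb'
    have hae : Odd a := by
      by_contra h
      have hb1 := hb.1
      have hb1' := hb'.1
      rw [if_neg h] at hb1
      rw [Nat.not_odd_iff] at h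
      rw [if_pos (by rw [Nat.odd_iff]; omega)] at hb1'
      omega
    have hb1 := hb.1
    rw [if_pos hae] at hb1
    rw [Nat.odd_iff] at hae
    have ht : t.countP Odd = 0 := by omega
    have ht' : (t.map (· / 2)).map (fun b => 2 * b) = t :=
      map_even_map_half (Multiset.countP_eq_zero.1 ht)
    have h00 : 0 ∉ t.map (· / 2) := by
      intro h
      apply h0
      rw [← ht']
      exact Multiset.mem_map.2 ⟨0, h, rfl⟩
    exact ⟨a / 2, t.map (· / 2), ⟨h00, by omega, hb.2⟩, by omega, ht'⟩
  · rintro ⟨a, t, ⟨h0, hs, hb⟩, rfl, rfl⟩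
    have hsum : (t.map (fun b => 2 * b)).sum = 2 * t.sum := by rw [Multiset.sum_map_mul_left]; simp
    have h00 : 0 ∉ t.map (fun b => 2 * b) := by simpa using h0
    have e1 : (2 * a + 1) / 2 = a := by omega
    have e2 : 2 * a / 2 = a := by omega
    rw [Nat.add_sub_cancel, bitDisjoint_iff_half (s := (2 * a + 1) ::ₘ _),
      bitDisjoint_iff_half (s := (2 * a) ::ₘ _),
      Multiset.countP_cons, Multiset.countP_cons, Multiset.map_cons, Multiset.map_cons,
      map_half_map_even, countP_odd_map_two_mul, e1, e2, hsum]
    refine ⟨⟨h00, by omega, ?_, hb⟩, h00, by omega, by omega, ?_, hb⟩ <;> split_ifs <;> simp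

lemma map_two_mul_injective : Function.Injective (Multiset.map (fun b : ℕ => 2 * b)) :=
  Multiset.map_injective fun a b h => by simpa using h

/-- The marked part must contain the lowest one of `N`, which leaves an unmarked set partition of
the ones. For `N = 0` there is no such bit and the intersection is empty, while `Nat.bell 0 = 1`. -/
theorem ncard_markedPairs_inter_raisedPairs {N : ℕ} (hN : N ≠ 0) :
    (markedPairs N ∩ raisedPairs N).ncard = Nat.bell (binaryOnes N) := by
  induction N using Nat.strong_induction_on with
  | _ N ih =>
    obtain ⟨m, rfl | rfl⟩ := Nat.even_or_odd' N
    · rw [inter_two_mul, Set.ncard_image_of_injective, ih m (by omega) (by omega),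
        binaryOnes_two_mul]
      rintro ⟨a, t⟩ ⟨b, u⟩ h
      simp only [Prod.mk.injEq] at h
      rw [map_two_mul_injective h.2, show a = b by omega]
    · rw [inter_two_mul_add_one, Set.ncard_image_of_injective, ncard_markedPairs,
        binaryOnes_two_mul_add_one]
      rintro ⟨a, t⟩ ⟨b, u⟩ h
      simp only [Prod.mk.injEq] at h
      rw [map_two_mul_injective h.2, show a = b by omega]

lemma ncard_symmDiff_add {α : Type*} {A B : Set α} (hA : A.Finite) (hB : B.Finite) :
    (symmDiff A B).ncard + 2 * (A ∩ B).ncard = A.ncard + B.ncard := by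
  have h1 := Set.ncard_inter_add_ncard_sdiff_eq_ncard A B hA
  have h2 := Set.ncard_inter_add_ncard_sdiff_eq_ncard B A hB
  rw [Set.inter_comm] at h2
  rw [Set.symmDiff_def, Set.ncard_union_eq disjoint_sdiff_sdiff hA.sdiff hB.sdiff]
  omega

/-! ### Determinants and signs of permutations. -/

section Sign

variable {X : Type*} [Fintype X] [DecidableEq X]

lemma det_funLeft_perm (σ : Equiv.Perm X) :
    LinearMap.det (LinearMap.funLeft ℂ ℂ σ) = ((Equiv.Perm.sign σ : ℤ) : ℂ) := by
  have : LinearMap.funLeft ℂ ℂ σ = Matrix.toLin' (σ.permMatrix ℂ) := by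
    refine LinearMap.ext fun f => ?_
    rw [Matrix.toLin'_apply, Matrix.permMatrix_mulVec]
    rfl
  rw [this, LinearMap.det_toLin', Matrix.det_permutation]

/-- If `p` selects one point from each two-element orbit of an involution, then the sign of the
involution is given by the number of selected points. -/
lemma sign_involution (σ : Equiv.Perm X) (hσ : ∀ x, σ (σ x) = x) (p : X → Prop) [DecidablePred p]
    (h : ∀ x, σ x ≠ x ↔ p x ∨ p (σ x)) (h' : ∀ x, ¬ (p x ∧ p (σ x))) :
    Equiv.Perm.sign σ = (-1) ^ (Finset.univ.filter p).card := by
  have h2 : σ ^ 2 = 1 := by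
    ext x
    simp [pow_two, hσ]
  have hsupp : σ.support = Finset.univ.filter p ∪ (Finset.univ.filter p).map σ.toEmbedding := by
    ext x
    simp only [Equiv.Perm.mem_support, h, Finset.mem_union, Finset.mem_filter, Finset.mem_univ,
      true_and, Finset.mem_map, Equiv.coe_toEmbedding]
    refine or_congr_right ⟨fun hx => ⟨σ x, hx, hσ x⟩, ?_⟩
    rintro ⟨y, hy, rfl⟩
    rwa [hσ]
  have hdisj : Disjoint (Finset.univ.filter p) ((Finset.univ.filter p).map σ.toEmbedding) := by
    rw [Finset.disjoint_left]
    intro x hx hx'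
    simp only [Finset.mem_filter, Finset.mem_univ, true_and, Finset.mem_map,
      Equiv.coe_toEmbedding] at hx hx'
    obtain ⟨y, hy, rfl⟩ := hx'
    exact h' y ⟨hy, hx⟩
  have hcard : σ.support.card = 2 * (Finset.univ.filter p).card := by
    rw [hsupp, Finset.card_union_of_disjoint hdisj, Finset.card_map, two_mul]
  -- All nontrivial cycles have length `2`, so there are half as many as points in the support.
  have hc := Equiv.Perm.cycleType_of_pow_prime_eq_one (p := 2) h2
  have hs := σ.sum_cycleType
  rw [Equiv.Perm.sign_of_cycleType, hs, hcard]
  rw [hc, Multiset.sum_replicate, hcard, smul_eq_mul] at hs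
  rw [show σ.cycleType.card = (Finset.univ.filter p).card by omega, pow_add, pow_mul]
  simp

end Sign

/-! ### Functions with prescribed fibre sizes and multinomial coefficients. -/

section Fibers

variable {ι : Type*}

/-- The number of functions `Fin n → ι` whose fibre over `i` has `μ i` elements, for all `i`. -/
def fiberCount [Fintype ι] [DecidableEq ι] (n : ℕ) (μ : ι → ℕ) : ℕ :=
  (Finset.univ.filter fun f : Fin n → ι => ∑ a, Pi.single (f a) 1 = μ).card

lemma card_filter_fin_succ [Fintype ι] {n : ℕ} (P : (Fin (n + 1) → ι) → Prop) [DecidablePred P] :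
    (Finset.univ.filter P).card =
      ∑ i : ι, (Finset.univ.filter fun g : Fin n → ι => P (Fin.cons i g)).card := by
  simp_rw [Finset.card_filter]
  rw [← Fintype.sum_prod_type']
  exact (Fintype.sum_equiv (Fin.consEquiv fun _ => ι) _ _ fun x => rfl).symm

lemma sum_single_cons [DecidableEq ι] {n : ℕ} (i : ι) (g : Fin n → ι) :
    ∑ a, (Pi.single ((Fin.cons i g : Fin (n + 1) → ι) a) 1 : ι → ℕ) =
      Pi.single i 1 + ∑ a, Pi.single (g a) 1 := by
  rw [Fin.sum_univ_succ]
  simp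

lemma single_le_iff [DecidableEq ι] {μ : ι → ℕ} {i : ι} : Pi.single i 1 ≤ μ ↔ 1 ≤ μ i := by
  constructor
  · intro h
    simpa using h i
  · intro h k
    rcases eq_or_ne k i with rfl | hk
    · simpa using h
    · simp [hk]

lemma sum_sub_single [Fintype ι] [DecidableEq ι] {μ : ι → ℕ} {i : ι} (h : 1 ≤ μ i) :
    ∑ k, (μ - Pi.single i 1 : ι → ℕ) k + 1 = ∑ k, μ k := by
  conv_rhs => rw [← tsub_add_cancel_of_le (single_le_iff.2 h)]
  simp [Finset.sum_add_distrib]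

lemma multinomial_sub_single_mul [Fintype ι] [DecidableEq ι] {μ : ι → ℕ} {i : ι} (h : 1 ≤ μ i) :
    Nat.multinomial Finset.univ (μ - Pi.single i 1) * (∑ k, μ k) =
      Nat.multinomial Finset.univ μ * μ i := by
  have h1 := Nat.multinomial_spec Finset.univ μ
  have h2 := Nat.multinomial_spec Finset.univ (μ - Pi.single i 1)
  have h4 := sum_sub_single h
  have hi : (μ - Pi.single i 1 : ι → ℕ) i = μ i - 1 := by simp
  have hk : ∀ k ≠ i, (μ - Pi.single i 1 : ι → ℕ) k = μ k := fun k hk => by simp [hk]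
  generalize (μ - Pi.single i 1 : ι → ℕ) = ν at *
  have h3 : ∏ k, (μ k).factorial = μ i * ∏ k, (ν k).factorial := by
    rw [← Finset.mul_prod_erase _ _ (Finset.mem_univ i),
      ← Finset.mul_prod_erase _ (fun k => (ν k).factorial) (Finset.mem_univ i), ← mul_assoc, hi,
      Nat.mul_factorial_pred (by omega)]
    congr 1
    exact Finset.prod_congr rfl fun k hk' => by rw [hk k (Finset.ne_of_mem_erase hk')]
  have hpos : 0 < ∏ k, (ν k).factorial := Finset.prod_pos fun _ _ => Nat.factorial_pos _
  apply Nat.eq_of_mul_eq_mul_left hpos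
  rw [← mul_assoc, h2, ← h4, mul_comm, ← Nat.factorial_succ, h4, ← h1, h3]
  ring

/-- Pascal's rule for multinomials: after multiplication by `∑ k, μ k`, the `i`-th term is `μ i`
times the full coefficient. The guard `1 ≤ μ i` excludes truncated subtractions. It serves both to
count functions and to settle the case of one odd part. -/
lemma sum_multinomial_sub_single [Fintype ι] [DecidableEq ι] {μ : ι → ℕ} (h : ∑ k, μ k ≠ 0) :
    ∑ i, (if 1 ≤ μ i then Nat.multinomial Finset.univ (μ - Pi.single i 1) else 0) =
      Nat.multinomial Finset.univ μ := by
  apply Nat.eq_of_mul_eq_mul_right (Nat.pos_of_ne_zero h)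
  rw [Finset.sum_mul]
  conv_rhs => rw [Finset.mul_sum]
  refine Finset.sum_congr rfl fun i _ => ?_
  split_ifs with hi
  · exact multinomial_sub_single_mul hi
  · rw [show μ i = 0 by omega]; simp

lemma fiberCount_eq_multinomial [Fintype ι] [DecidableEq ι] {n : ℕ} {μ : ι → ℕ} (h : ∑ k, μ k = n) :
    fiberCount n μ = Nat.multinomial Finset.univ μ := by
  induction n generalizing μ with
  | zero =>
    have : μ = 0 := funext fun k => by
      simpa using (Finset.sum_eq_zero_iff.1 h) k (Finset.mem_univ k)
    subst this
    simp [fiberCount, Nat.multinomial]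
  | succ n ih =>
    rw [← sum_multinomial_sub_single (by omega), fiberCount, card_filter_fin_succ]
    refine Finset.sum_congr rfl fun i _ => ?_
    simp_rw [sum_single_cons]
    split_ifs with hi
    · have h1 := sum_sub_single hi
      rw [← ih (by omega), fiberCount]
      congr 1
      refine Finset.filter_congr fun g _ => ?_
      rw [eq_tsub_iff_add_eq_of_le (single_le_iff.2 hi), add_comm]
    · rw [Finset.card_eq_zero, Finset.filter_eq_empty_iff]
      rintro g - rfl
      simp at hi

/-- Fixing the values `i < j` at `0` and `1` leaves a free function on `m` points with the remaining
fibre sizes. -/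
lemma card_filter_fiber_lt [Fintype ι] [DecidableEq ι] [LinearOrder ι] {m : ℕ} {μ : ι → ℕ} (hμ : ∀ i, 1 ≤ μ i)
    (h : ∑ k, μ k = m + 2) :
    (Finset.univ.filter fun f : Fin (m + 2) → ι =>
      ∑ a, Pi.single (f a) 1 = μ ∧ f 0 < f 1).card =
    ∑ p : ι × ι, if p.1 < p.2 then
      Nat.multinomial Finset.univ (μ - Pi.single p.1 1 - Pi.single p.2 1) else 0 := by
  rw [card_filter_fin_succ, Fintype.sum_prod_type]
  refine Finset.sum_congr rfl fun i _ => ?_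
  rw [card_filter_fin_succ]
  refine Finset.sum_congr rfl fun j _ => ?_
  simp_rw [sum_single_cons]
  have e0 (g : Fin m → ι) : (Fin.cons i (Fin.cons j g : Fin (m + 1) → ι) : Fin (m + 2) → ι) 0 = i :=
    rfl
  have e1 (g : Fin m → ι) : (Fin.cons i (Fin.cons j g : Fin (m + 1) → ι) : Fin (m + 2) → ι) 1 = j :=
    rfl
  simp_rw [e0, e1]
  split_ifs with hij
  · have hi := hμ i
    have hj : 1 ≤ (μ - Pi.single i 1 : ι → ℕ) j := by simpa [hij.ne'] using hμ j
    have h1 := sum_sub_single hi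
    have h2 := sum_sub_single hj
    rw [← fiberCount_eq_multinomial (n := m) (by omega), fiberCount]
    congr 1
    refine Finset.filter_congr fun g _ => ?_
    rw [eq_tsub_iff_add_eq_of_le (single_le_iff.2 hj), eq_tsub_iff_add_eq_of_le (single_le_iff.2 hi),
      and_iff_left hij]
    constructor <;> rintro rfl <;> abel
  · simp [hij]

lemma multinomial_univ_eq [DecidableEq ι] (μ : ι → ℕ) (s : Finset ι) :
    Nat.multinomial s μ = (s.val.map μ).multinomial := by
  induction s using Finset.induction_on with
  | empty => simp
  | insert a s ha ih =>
    rw [Nat.multinomial_insert ha, Finset.insert_val_of_notMem ha, Multiset.map_cons,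
      Multiset.multinomial_cons, ih]
    rfl

lemma odd_multinomial_univ_iff [Fintype ι] [DecidableEq ι] (μ : ι → ℕ) :
    Odd (Nat.multinomial Finset.univ μ) ↔ BitDisjoint (Finset.univ.val.map μ) := by
  rw [multinomial_univ_eq, odd_multinomial_iff]

end Fibers

/-! ### Tuples of blocks as functions to the block indices. -/

section Chiral

/-- The block sizes of the set partitions of shape `lam`, as a function on the set of blocks. -/
def blockSize {n : ℕ} (lam : n.Partition) : Fin (partList lam).length → ℕ := (partList lam).get

lemma map_blockSize {n : ℕ} (lam : n.Partition) :
    Finset.univ.val.map (blockSize lam) = lam.parts := by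
  have h1 : Finset.univ.val.map (blockSize lam) = (List.ofFn (blockSize lam) : Multiset ℕ) := by
    rw [Fin.univ_val_map]
  rw [h1, blockSize, List.ofFn_get, partList, Multiset.sort_eq]

lemma sum_single_apply_eq {n : ℕ} {ι : Type*} [DecidableEq ι] (f : Fin n → ι) (i : ι) :
    (∑ a, (Pi.single (f a) 1 : ι → ℕ)) i = (Finset.univ.filter fun a => f a = i).card := by
  rw [Finset.sum_apply, Finset.card_filter]
  refine Finset.sum_congr rfl fun a _ => ?_
  rw [Pi.single_apply]
  simp [eq_comm]

/-- A tuple of disjoint blocks covering `Fin n` is the tuple of fibres of a function. -/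
noncomputable def setPartitionsEquiv {n : ℕ} (lam : n.Partition) :
    {f : Fin n → Fin (partList lam).length // ∑ a, Pi.single (f a) 1 = blockSize lam} ≃
      SetPartitionsOfShape lam :=
  Equiv.ofBijective (fun f => ⟨fun i => Finset.univ.filter fun a => f.1 a = i, by
    refine ⟨fun i j hij => ?_, fun a => ⟨f.1 a, by simp⟩, fun i => ?_⟩
    · rw [Finset.disjoint_left]
      intro a ha hb
      simp only [Finset.mem_filter, Finset.mem_univ, true_and] at ha hb
      exact hij (ha ▸ hb)
    · rw [← sum_single_apply_eq, f.2]
      rfl⟩) (by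
    constructor
    · intro f g h
      apply Subtype.ext
      funext a
      have h1 := congrFun (congrArg Subtype.val h) (f.1 a)
      have h2 : a ∈ Finset.univ.filter fun b => f.1 b = f.1 a := by simp
      dsimp only at h1
      rw [h1] at h2
      exact ((Finset.mem_filter.1 h2).2).symm
    · rintro ⟨X, hX⟩
      obtain ⟨hd, hc, hs⟩ := id hX
      choose f hf using hc
      have key (i) : (Finset.univ.filter fun a => f a = i) = X i := by
        ext a
        simp only [Finset.mem_filter, Finset.mem_univ, true_and]
        constructor
        · rintro rfl
          exact hf a
        · intro ha
          by_contra hne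
          exact Finset.disjoint_left.1 (hd _ _ hne) (hf a) ha
      refine ⟨⟨f, funext fun i => ?_⟩, Subtype.ext (funext key)⟩
      rw [sum_single_apply_eq, key, hs]
      rfl)

end Chiral

section

variable {n : ℕ} {lam : n.Partition}

/-- The index of the block of `x` which contains a given element. -/
noncomputable def blockIndex (x : SetPartitionsOfShape lam) : Fin n → Fin (partList lam).length :=
  ((setPartitionsEquiv lam).symm x).1

lemma sum_single_blockIndex (x : SetPartitionsOfShape lam) :
    ∑ a, Pi.single (blockIndex x a) 1 = blockSize lam :=
  ((setPartitionsEquiv lam).symm x).2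

lemma mem_setPartitionsEquiv
    (f : {f : Fin n → Fin (partList lam).length // ∑ a, Pi.single (f a) 1 = blockSize lam})
    (a : Fin n) (i) : a ∈ (setPartitionsEquiv lam f).1 i ↔ f.1 a = i := by
  change a ∈ Finset.univ.filter (fun a => f.1 a = i) ↔ _
  simp

lemma mem_iff_blockIndex_eq (x : SetPartitionsOfShape lam) (a : Fin n) (i) :
    a ∈ x.1 i ↔ blockIndex x a = i := by
  conv_lhs => rw [← (setPartitionsEquiv lam).apply_symm_apply x]
  exact mem_setPartitionsEquiv _ a i

lemma blockIndex_injective : Function.Injective (blockIndex (lam := lam)) := fun _ _ h =>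
  (setPartitionsEquiv lam).symm.injective (Subtype.ext h)

lemma blockIndex_smul (g : Equiv.Perm (Fin n)) (x : SetPartitionsOfShape lam) (a : Fin n) :
    blockIndex (g • x) a = blockIndex x (g⁻¹ a) := by
  have h : a ∈ (g • x).1 (blockIndex x (g⁻¹ a)) ↔ g.symm a ∈ x.1 (blockIndex x (g⁻¹ a)) :=
    Finset.mem_map_equiv
  rw [← mem_iff_blockIndex_eq, h, mem_iff_blockIndex_eq]
  rfl

lemma exists_blockIndex_eq {f : Fin n → Fin (partList lam).length}
    (h : ∑ a, Pi.single (f a) 1 = blockSize lam) : ∃ x, blockIndex (lam := lam) x = f :=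
  ⟨setPartitionsEquiv lam ⟨f, h⟩, by simp [blockIndex]⟩

open Classical in
lemma det_permRep [Fintype (SetPartitionsOfShape lam)] (g : Equiv.Perm (Fin n)) :
    LinearMap.det (permRep lam g) = ((Equiv.Perm.sign
      (MulAction.toPermHom (Equiv.Perm (Fin n)) (SetPartitionsOfShape lam) g) : ℤ) : ℂ) := by
  -- Functions are pulled back along `g⁻¹`, which has the same sign as `g`.
  rw [← Equiv.Perm.sign_inv, ← map_inv, ← det_funLeft_perm]
  rfl

end

/-! ### Chirality as a parity condition on pairs of blocks. -/

section

variable {m : ℕ} (lam : (m + 2).Partition)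

-- If the transposition acts with sign `-1`, then `g ↦` sign of `g` on `X_λ` is a surjection onto
-- `ℤˣ`, and the only such character of a symmetric group is `sign`.
open Classical in
lemma isChiral_iff_sign [Fintype (SetPartitionsOfShape lam)] :
    IsChiral (permRep lam) ↔ Equiv.Perm.sign (MulAction.toPermHom (Equiv.Perm (Fin (m + 2)))
      (SetPartitionsOfShape lam) (Equiv.swap 0 1)) = -1 := by
  constructor
  · intro h
    have h1 := h (Equiv.swap 0 1)
    rw [det_permRep, Equiv.Perm.sign_swap (by simp)] at h1
    apply Units.ext
    exact_mod_cast h1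
  · intro h g
    let s : Equiv.Perm (Fin (m + 2)) →* ℤˣ :=
      Equiv.Perm.sign.comp (MulAction.toPermHom _ (SetPartitionsOfShape lam))
    have hs : Function.Surjective s := by
      intro u
      rcases Int.units_eq_one_or u with rfl | rfl
      · exact ⟨1, map_one s⟩
      · exact ⟨Equiv.swap 0 1, h⟩
    rw [det_permRep, ← Equiv.Perm.eq_sign_of_surjective_hom hs]
    rfl

/-- The swap exchanges the block indices of `0` and `1`, so it fixes a tuple iff they agree;
otherwise exactly one member of each orbit has them in increasing order. -/
lemma sign_swap_smul [Fintype (SetPartitionsOfShape lam)] [DecidableEq (SetPartitionsOfShape lam)] :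
    Equiv.Perm.sign (MulAction.toPermHom (Equiv.Perm (Fin (m + 2)))
      (SetPartitionsOfShape lam) (Equiv.swap 0 1)) =
    (-1) ^ (Finset.univ.filter fun x : SetPartitionsOfShape lam =>
      blockIndex x 0 < blockIndex x 1).card := by
  have h0 (x : SetPartitionsOfShape lam) :
      blockIndex (Equiv.swap (0 : Fin (m + 2)) 1 • x) 0 = blockIndex x 1 := by
    rw [blockIndex_smul]; simp
  have h1 (x : SetPartitionsOfShape lam) :
      blockIndex (Equiv.swap (0 : Fin (m + 2)) 1 • x) 1 = blockIndex x 0 := by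
    rw [blockIndex_smul]; simp
  refine sign_involution _ (fun x => ?_) _ (fun x => ?_) fun x => ?_
  · change Equiv.swap (0 : Fin (m + 2)) 1 • Equiv.swap (0 : Fin (m + 2)) 1 • x = x
    rw [smul_smul, Equiv.swap_mul_self, one_smul]
  · change Equiv.swap (0 : Fin (m + 2)) 1 • x ≠ x ↔ _ ∨
      blockIndex (Equiv.swap (0 : Fin (m + 2)) 1 • x) 0 <
        blockIndex (Equiv.swap (0 : Fin (m + 2)) 1 • x) 1
    rw [h0, h1, ← ne_iff_lt_or_gt, not_iff_not]
    constructor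
    · intro h
      rw [← h1, h]
    · intro h
      refine blockIndex_injective (funext fun a => ?_)
      rw [blockIndex_smul, Equiv.swap_inv]
      rw [Equiv.swap_apply_def]
      split_ifs with h3 h4
      · rw [h3, h]
      · rw [h4, h]
      · rfl
  · change ¬ (_ ∧ blockIndex (Equiv.swap (0 : Fin (m + 2)) 1 • x) 0 <
        blockIndex (Equiv.swap (0 : Fin (m + 2)) 1 • x) 1)
    rw [h0, h1]
    exact fun h => lt_asymm h.1 h.2

lemma one_le_blockSize {n : ℕ} (lam : n.Partition) (i) : 1 ≤ blockSize lam i := by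
  have h : blockSize lam i ∈ lam.parts := by
    rw [← map_blockSize]
    exact Multiset.mem_map_of_mem _ (Finset.mem_univ i)
  exact lam.parts_pos h

lemma sum_blockSize {n : ℕ} (lam : n.Partition) : ∑ i, blockSize lam i = n := by
  conv_rhs => rw [← lam.parts_sum, ← map_blockSize]
  rfl

open Classical in
/-- The representation on `ℂ[X_λ]` is chiral iff an odd number of the multinomial coefficients
counting the tuples with given distinct blocks containing `0` and `1` are odd. -/
theorem isChiral_iff_odd_card : IsChiral (permRep lam) ↔
    Odd (Finset.univ.filter fun p : Fin (partList lam).length × Fin (partList lam).length =>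
      p.1 < p.2 ∧ BitDisjoint (Finset.univ.val.map
        (blockSize lam - Pi.single p.1 1 - Pi.single p.2 1))).card := by
  let _ : Fintype (SetPartitionsOfShape lam) := Fintype.ofFinite _
  have hcard : (Finset.univ.filter fun x : SetPartitionsOfShape lam =>
      blockIndex x 0 < blockIndex x 1).card =
      (Finset.univ.filter fun f : Fin (m + 2) → Fin (partList lam).length =>
        ∑ a, Pi.single (f a) 1 = blockSize lam ∧ f 0 < f 1).card := by
    refine Finset.card_bij (fun x _ => blockIndex x) ?_ ?_ ?_
    · intro x hx
      simpa [sum_single_blockIndex] using hx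
    · intro x _ y _ h
      exact blockIndex_injective h
    · intro f hf
      simp only [Finset.mem_filter, Finset.mem_univ, true_and] at hf
      obtain ⟨x, rfl⟩ := exists_blockIndex_eq hf.1
      exact ⟨x, by simpa using hf.2, rfl⟩
  have hodd (k : ℕ) : ((-1 : ℤˣ)) ^ k = -1 ↔ Odd k := by
    rcases Nat.even_or_odd k with h | h
    · simp [h.neg_one_pow, Nat.not_odd_iff_even.2 h, (by decide : (1 : ℤˣ) ≠ -1)]
    · simp [h.neg_one_pow, h]
  rw [isChiral_iff_sign, sign_swap_smul, hodd, hcard,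
    card_filter_fiber_lt (one_le_blockSize lam) (sum_blockSize lam),
    Finset.odd_sum_iff_odd_card_odd]
  congr! 4 with p
  split_ifs with h
  · simp [h, odd_multinomial_univ_iff]
  · simp [h]

end

/-! ### Parity of the number of good pairs, by the number of odd sizes. -/

section

variable {ι : Type*}

lemma countP_odd_map_univ [Fintype ι] (μ : ι → ℕ) :
    (Finset.univ.val.map μ).countP Odd = (Finset.univ.filter fun i => Odd (μ i)).card := by
  rw [Multiset.countP_map]
  rfl

lemma sum_eq_two_mul_half_sum_add_card_odd [Fintype ι] (μ : ι → ℕ) :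
    ∑ i, μ i = 2 * ∑ i, μ i / 2 + (Finset.univ.filter fun i => Odd (μ i)).card := by
  have h := sum_eq_two_mul_half_sum_add (Finset.univ.val.map μ)
  rwa [countP_odd_map_univ, Multiset.map_map] at h

lemma bitDisjoint_map_univ_iff_half [Fintype ι] (μ : ι → ℕ) :
    BitDisjoint (Finset.univ.val.map μ) ↔ (Finset.univ.filter fun i => Odd (μ i)).card ≤ 1 ∧
      BitDisjoint (Finset.univ.val.map fun i => μ i / 2) := by
  rw [bitDisjoint_iff_half, countP_odd_map_univ, Multiset.map_map]
  rfl

lemma sub_single_sub_single_apply [DecidableEq ι] (μ : ι → ℕ) {i j : ι} (hij : i ≠ j) (k : ι) :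
    (μ - Pi.single i 1 - Pi.single j 1 : ι → ℕ) k = if k = i ∨ k = j then μ k - 1 else μ k := by
  rcases eq_or_ne k i with rfl | hi
  · simp [hij]
  · rcases eq_or_ne k j with rfl | hj
    · simp [hi]
    · simp [hi, hj]

lemma card_filter_lt_pairs [DecidableEq ι] [LinearOrder ι] [Fintype ι] (O : Finset ι) :
    2 * (Finset.univ.filter fun p : ι × ι => p.1 < p.2 ∧ p.1 ∈ O ∧ p.2 ∈ O).card =
      O.card * O.card - O.card := by
  have h1 : O.offDiag = (Finset.univ.filter fun p : ι × ι => p.1 < p.2 ∧ p.1 ∈ O ∧ p.2 ∈ O) ∪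
      (Finset.univ.filter fun p : ι × ι => p.2 < p.1 ∧ p.1 ∈ O ∧ p.2 ∈ O) := by
    ext ⟨a, b⟩
    simp only [Finset.mem_offDiag, Finset.mem_union, Finset.mem_filter, Finset.mem_univ, true_and,
      ← or_and_right, ← ne_iff_lt_or_gt]
    tauto
  have h2 : (Finset.univ.filter fun p : ι × ι => p.2 < p.1 ∧ p.1 ∈ O ∧ p.2 ∈ O).card =
      (Finset.univ.filter fun p : ι × ι => p.1 < p.2 ∧ p.1 ∈ O ∧ p.2 ∈ O).card := by
    refine Finset.card_equiv (Equiv.prodComm ι ι) fun p => ?_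
    simp only [Finset.mem_filter, Finset.mem_univ, true_and, Equiv.prodComm_apply, Prod.fst_swap,
      Prod.snd_swap]
    tauto
  rw [← Finset.offDiag_card, h1, Finset.card_union_of_disjoint, h2, two_mul]
  rw [Finset.disjoint_left]
  intro p hp hp'
  exact lt_asymm (Finset.mem_filter.1 hp).2.1 (Finset.mem_filter.1 hp').2.1

variable [Fintype ι] [DecidableEq ι] {μ : ι → ℕ} {i j : ι}

/-- Lowering two odd entries clears two last bits and keeps every half, so `≤ 1` odd entries
afterwards means `≤ 3` before. -/
lemma bitDisjoint_sub_of_odd_odd (hij : i ≠ j) (hi : Odd (μ i)) (hj : Odd (μ j)) :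
    BitDisjoint (Finset.univ.val.map (μ - Pi.single i 1 - Pi.single j 1)) ↔
      (Finset.univ.filter fun i => Odd (μ i)).card ≤ 3 ∧
        BitDisjoint (Finset.univ.val.map fun i => μ i / 2) := by
  rw [bitDisjoint_map_univ_iff_half]
  simp only [sub_single_sub_single_apply μ hij]
  have h1 : (Finset.univ.filter fun k => Odd (if k = i ∨ k = j then μ k - 1 else μ k)) =
      ((Finset.univ.filter fun i => Odd (μ i)).erase i).erase j := by
    ext k
    rw [Nat.odd_iff] at hi hj
    simp only [Finset.mem_filter, Finset.mem_univ, true_and, Finset.mem_erase, Nat.odd_iff]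
    split_ifs with h
    · rcases h with rfl | rfl
      · simp; omega
      · simp; omega
    · tauto
  have h2 : (fun k => (if k = i ∨ k = j then μ k - 1 else μ k) / 2) = fun k => μ k / 2 := by
    funext k
    rw [Nat.odd_iff] at hi hj
    split_ifs with h
    · rcases h with rfl | rfl <;> omega
    · rfl
  rw [h1, h2, Finset.card_erase_of_mem (by simp [hij.symm, hj]),
    Finset.card_erase_of_mem (by simp [hi])]
  refine and_congr_left fun _ => ?_
  omega

/-- The lowered odd entry becomes even with the same half, the lowered even one becomes odd with
half one less; the number of odd entries is unchanged. -/
lemma bitDisjoint_sub_of_odd_even (hi : Odd (μ i)) (hj : ¬ Odd (μ j)) (hj1 : 1 ≤ μ j) :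
    BitDisjoint (Finset.univ.val.map (μ - Pi.single i 1 - Pi.single j 1)) ↔
      (Finset.univ.filter fun i => Odd (μ i)).card ≤ 1 ∧
        BitDisjoint (Finset.univ.val.map ((fun i => μ i / 2) - Pi.single j 1)) := by
  have hij : i ≠ j := by
    rintro rfl
    exact hj hi
  rw [bitDisjoint_map_univ_iff_half]
  simp only [sub_single_sub_single_apply μ hij]
  have h1 : (Finset.univ.filter fun k => Odd (if k = i ∨ k = j then μ k - 1 else μ k)) =
      insert j ((Finset.univ.filter fun i => Odd (μ i)).erase i) := by
    ext k
    rw [Nat.odd_iff] at hi hj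
    simp only [Finset.mem_filter, Finset.mem_univ, true_and, Finset.mem_erase, Nat.odd_iff,
      Finset.mem_insert]
    split_ifs with h
    · rcases h with rfl | rfl
      · simp [hij]; omega
      · simp; omega
    · tauto
  have h2 : (fun k => (if k = i ∨ k = j then μ k - 1 else μ k) / 2) =
      (fun i => μ i / 2) - Pi.single j 1 := by
    funext k
    rw [Nat.odd_iff] at hi hj
    rcases eq_or_ne k j with rfl | hkj
    · simp; omega
    · rcases eq_or_ne k i with rfl | hki
      · simp [hkj]; omega
      · simp [hkj, hki]
  have h3 : 0 < (Finset.univ.filter fun i => Odd (μ i)).card :=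
    Finset.card_pos.2 ⟨i, by simp [hi]⟩
  rw [h1, h2, Finset.card_insert_of_notMem (by simp [hj]), Finset.card_erase_of_mem (by simp [hi])]
  refine and_congr_left fun _ => ?_
  omega

lemma not_bitDisjoint_sub_of_even_even (hij : i ≠ j) (hi : ¬ Odd (μ i)) (hj : ¬ Odd (μ j))
    (hi1 : 1 ≤ μ i) (hj1 : 1 ≤ μ j) :
    ¬ BitDisjoint (Finset.univ.val.map (μ - Pi.single i 1 - Pi.single j 1)) := by
  rw [bitDisjoint_map_univ_iff_half]
  rintro ⟨h, -⟩
  refine hij (Finset.card_le_one.1 h i ?_ j ?_)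
  · rw [Nat.odd_iff] at hi
    simp only [sub_single_sub_single_apply μ hij, Finset.mem_filter, Finset.mem_univ, true_and,
      Nat.odd_iff, true_or, if_true]
    omega
  · rw [Nat.odd_iff] at hj
    simp only [sub_single_sub_single_apply μ hij, Finset.mem_filter, Finset.mem_univ, true_and,
      Nat.odd_iff, or_true, if_true]
    omega

lemma bitDisjoint_sub_comm :
    BitDisjoint (Finset.univ.val.map (μ - Pi.single i 1 - Pi.single j 1)) ↔
      BitDisjoint (Finset.univ.val.map (μ - Pi.single j 1 - Pi.single i 1)) := by
  rw [tsub_right_comm]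

variable [LinearOrder ι]

-- Pairs with an even member would need at most one odd entry, so only odd-odd pairs can count, and
-- they all do or none does. There are `1` or `3` of them when the number of odd entries is `2` or
-- `3`.
open Classical in
theorem odd_card_pairs_of_two_le_card (hμ : ∀ i, 1 ≤ μ i)
    (hO : 2 ≤ (Finset.univ.filter fun i => Odd (μ i)).card) :
    Odd (Finset.univ.filter fun p : ι × ι => p.1 < p.2 ∧ BitDisjoint (Finset.univ.val.map
      (μ - Pi.single p.1 1 - Pi.single p.2 1))).card ↔
      (Finset.univ.filter fun i => Odd (μ i)).card ≤ 3 ∧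
        BitDisjoint (Finset.univ.val.map fun i => μ i / 2) := by
  have key (i j : ι) (hij : i < j) :
      BitDisjoint (Finset.univ.val.map (μ - Pi.single i 1 - Pi.single j 1)) ↔
        (Odd (μ i) ∧ Odd (μ j)) ∧ (Finset.univ.filter fun i => Odd (μ i)).card ≤ 3 ∧
        BitDisjoint (Finset.univ.val.map fun i => μ i / 2) := by
    by_cases hi : Odd (μ i) <;> by_cases hj : Odd (μ j)
    · rw [bitDisjoint_sub_of_odd_odd hij.ne hi hj]
      tauto
    · rw [bitDisjoint_sub_of_odd_even hi hj (hμ j)]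
      constructor
      · rintro ⟨h, -⟩; omega
      · tauto
    · rw [bitDisjoint_sub_comm, bitDisjoint_sub_of_odd_even hj hi (hμ i)]
      constructor
      · rintro ⟨h, -⟩; omega
      · tauto
    · have := not_bitDisjoint_sub_of_even_even hij.ne hi hj (hμ i) (hμ j)
      tauto
  by_cases h : (Finset.univ.filter fun i => Odd (μ i)).card ≤ 3 ∧
        BitDisjoint (Finset.univ.val.map fun i => μ i / 2)
  · have h1 := card_filter_lt_pairs (Finset.univ.filter fun i => Odd (μ i))
    have h2 : (Finset.univ.filter fun p : ι × ι => p.1 < p.2 ∧ BitDisjoint (Finset.univ.val.map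
        (μ - Pi.single p.1 1 - Pi.single p.2 1))) =
        Finset.univ.filter fun p : ι × ι => p.1 < p.2 ∧
          p.1 ∈ (Finset.univ.filter fun i => Odd (μ i)) ∧
          p.2 ∈ (Finset.univ.filter fun i => Odd (μ i)) := by
      refine Finset.filter_congr fun p _ => and_congr_right fun hp => ?_
      rw [key _ _ hp]
      simp only [Finset.mem_filter, Finset.mem_univ, true_and]
      tauto
    rw [h2, iff_true_right h]
    obtain h3 | h3 : (Finset.univ.filter fun i => Odd (μ i)).card = 2 ∨
      (Finset.univ.filter fun i => Odd (μ i)).card = 3 := by omega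
    · rw [h3] at h1
      exact ⟨0, by omega⟩
    · rw [h3] at h1
      exact ⟨1, by omega⟩
  · rw [iff_false_right h, Finset.filter_eq_empty_iff.2]
    · simp
    · rintro p - ⟨hp, hb⟩
      rw [key _ _ hp] at hb
      exact h hb.2

-- A good pair must contain `i`, so one counts the `k ≠ i` with `η - e_k` bit-disjoint. Pascal's
-- rule for `η` gives the parity over all `k`, and the term `k = i` is then removed. The hypothesis
-- `hsum` ensures `η ≠ 0`, where that rule would fail.
open Classical in
theorem odd_card_pairs_of_card_eq_one (hμ : ∀ i, 1 ≤ μ i)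
    (hO : (Finset.univ.filter fun i => Odd (μ i)) = {i}) (hsum : ∑ k, μ k ≠ 1) :
    Odd (Finset.univ.filter fun p : ι × ι => p.1 < p.2 ∧ BitDisjoint (Finset.univ.val.map
      (μ - Pi.single p.1 1 - Pi.single p.2 1))).card ↔
      ¬ (BitDisjoint (Finset.univ.val.map fun k => μ k / 2) ↔
        (1 ≤ μ i / 2 ∧ BitDisjoint (Finset.univ.val.map ((fun k => μ k / 2) - Pi.single i 1)))) := by
  have hodd (k : ι) : Odd (μ k) ↔ k = i := by
    rw [← Finset.mem_singleton, ← hO]; simp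
  have hi : Odd (μ i) := (hodd i).2 rfl
  set η : ι → ℕ := fun k => μ k / 2 with hη
  have hη1 (k : ι) (hk : k ≠ i) : 1 ≤ η k := by
    have h1 := hμ k
    have h2 : ¬ Odd (μ k) := fun h => hk ((hodd k).1 h)
    rw [Nat.odd_iff] at h2
    simp only [hη]
    omega
  have key (k : ι) (hk : k ≠ i) :
      BitDisjoint (Finset.univ.val.map (μ - Pi.single i 1 - Pi.single k 1)) ↔
        BitDisjoint (Finset.univ.val.map (η - Pi.single k 1)) := by
    rw [bitDisjoint_sub_of_odd_even hi (fun h => hk ((hodd k).1 h)) (hμ k), hO, Finset.card_singleton]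
    exact and_iff_right le_rfl
  have hcard : (Finset.univ.filter fun p : ι × ι => p.1 < p.2 ∧ BitDisjoint (Finset.univ.val.map
      (μ - Pi.single p.1 1 - Pi.single p.2 1))).card =
      (Finset.univ.filter fun k => k ≠ i ∧
        BitDisjoint (Finset.univ.val.map (η - Pi.single k 1))).card := by
    symm
    -- Each ordered pair containing `i` is encoded by its other member.
    refine Finset.card_bij (fun k _ => if k < i then (k, i) else (i, k)) ?_ ?_ ?_
    · intro k hk
      simp only [Finset.mem_filter, Finset.mem_univ, true_and] at hk ⊢
      rw [← key k hk.1] at hk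
      split_ifs with h
      · exact ⟨h, bitDisjoint_sub_comm.1 hk.2⟩
      · exact ⟨lt_of_le_of_ne (not_lt.1 h) hk.1.symm, hk.2⟩
    · intro a ha b hb hab
      simp only [Finset.mem_filter, Finset.mem_univ, true_and] at ha hb
      split_ifs at hab with h1 h2 h2
      · exact (Prod.ext_iff.1 hab).1
      · exact absurd (Prod.ext_iff.1 hab).1 ha.1
      · exact absurd (Prod.ext_iff.1 hab).1.symm hb.1
      · exact (Prod.ext_iff.1 hab).2
    · rintro ⟨a, b⟩ hab
      simp only [Finset.mem_filter, Finset.mem_univ, true_and] at hab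
      obtain ⟨hlt, hb⟩ := hab
      rcases eq_or_ne a i with rfl | ha
      · refine ⟨b, ?_, by rw [if_neg hlt.le.not_gt]⟩
        simp only [Finset.mem_filter, Finset.mem_univ, true_and]
        exact ⟨hlt.ne', (key b hlt.ne').1 hb⟩
      · rcases eq_or_ne b i with rfl | hbi
        · refine ⟨a, ?_, by rw [if_pos hlt]⟩
          simp only [Finset.mem_filter, Finset.mem_univ, true_and]
          exact ⟨ha, (key a ha).1 (bitDisjoint_sub_comm.1 hb)⟩
        · exact absurd hb (not_bitDisjoint_sub_of_even_even hlt.ne (fun h => ha ((hodd a).1 h))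
            (fun h => hbi ((hodd b).1 h)) (hμ a) (hμ b))
  have hsum' : ∑ k, η k ≠ 0 := by
    have h1 := sum_eq_two_mul_half_sum_add_card_odd μ
    rw [hO, Finset.card_singleton] at h1
    intro h0
    exact hsum (by rw [h1, h0])
  have hpar : BitDisjoint (Finset.univ.val.map η) ↔ Odd (Finset.univ.filter fun k => 1 ≤ η k ∧
      BitDisjoint (Finset.univ.val.map (η - Pi.single k 1))).card := by
    rw [← odd_multinomial_univ_iff, ← sum_multinomial_sub_single hsum',
      Finset.odd_sum_iff_odd_card_odd]
    congr! 4 with k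
    split_ifs with h
    · simp [h, odd_multinomial_univ_iff]
    · simp [h]
  have hsplit : (Finset.univ.filter fun k => 1 ≤ η k ∧
      BitDisjoint (Finset.univ.val.map (η - Pi.single k 1))).card =
      (Finset.univ.filter fun k => k ≠ i ∧
        BitDisjoint (Finset.univ.val.map (η - Pi.single k 1))).card +
      if 1 ≤ η i ∧ BitDisjoint (Finset.univ.val.map (η - Pi.single i 1)) then 1 else 0 := by
    simp_rw [Finset.card_filter]
    rw [← Finset.add_sum_erase _ _ (Finset.mem_univ i),
      ← Finset.add_sum_erase Finset.univ (fun k => if k ≠ i ∧ _ then 1 else 0) (Finset.mem_univ i)]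
    rw [if_neg (show ¬ (i ≠ i ∧ _) from fun h => h.1 rfl), zero_add, add_comm]
    congr 1
    refine Finset.sum_congr rfl fun k hk => ?_
    have hk' := Finset.ne_of_mem_erase hk
    simp [hk', hη1 k hk']
  rw [hcard, hpar, hsplit]
  change _ ↔ ¬ (_ ↔ (1 ≤ η i ∧ _))
  split_ifs with h
  · rw [iff_true_right h, Nat.odd_add_one, not_not]
  · rw [iff_false_right h, add_zero, not_not]

end

/-! ### From partitions to multisets, and the count of chiral representations. -/

section

lemma zero_notMem_parts {n : ℕ} (lam : n.Partition) : 0 ∉ lam.parts :=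
  fun h => (lam.parts_pos h).ne' rfl

lemma map_blockSize_half {n : ℕ} (lam : n.Partition) :
    (Finset.univ.val.map fun i => blockSize lam i / 2) = lam.parts.map (· / 2) := by
  rw [← map_blockSize, Multiset.map_map]
  rfl

lemma card_odd_blockSize {n : ℕ} (lam : n.Partition) :
    (Finset.univ.filter fun i => Odd (blockSize lam i)).card = lam.parts.countP Odd := by
  rw [← countP_odd_map_univ, map_blockSize]

lemma isChiral_iff_of_two_le_countP {m : ℕ} (lam : (m + 2).Partition)
    (h : 2 ≤ lam.parts.countP Odd) : IsChiral (permRep lam) ↔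
      lam.parts.countP Odd ≤ 3 ∧ BitDisjoint (lam.parts.map (· / 2)) := by
  rw [← card_odd_blockSize] at h
  have h2 := odd_card_pairs_of_two_le_card (one_le_blockSize lam) h
  rw [card_odd_blockSize, map_blockSize_half] at h2
  rw [isChiral_iff_odd_card, ← h2]

lemma not_isChiral_of_countP_eq_zero {m : ℕ} (lam : (m + 2).Partition)
    (h : lam.parts.countP Odd = 0) : ¬ IsChiral (permRep lam) := by
  classical
  have heven (i) : ¬ Odd (blockSize lam i) := by
    rw [← card_odd_blockSize, Finset.card_eq_zero, Finset.filter_eq_empty_iff] at h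
    exact h (Finset.mem_univ i)
  rw [isChiral_iff_odd_card, Finset.filter_eq_empty_iff.2]
  · simp
  · rintro p - ⟨hp, hb⟩
    exact not_bitDisjoint_sub_of_even_even hp.ne (heven _) (heven _) (one_le_blockSize lam _)
      (one_le_blockSize lam _) hb

lemma isChiral_iff_of_countP_eq_one {m : ℕ} (lam : (m + 2).Partition)
    (h : lam.parts.countP Odd = 1) : ∃ x, lam.parts = oddConsEven x ∧
      (IsChiral (permRep lam) ↔ ¬ (BitDisjoint (x.1 ::ₘ x.2) ↔
        (1 ≤ x.1 ∧ BitDisjoint ((x.1 - 1) ::ₘ x.2)))) := by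
  rw [← card_odd_blockSize, Finset.card_eq_one] at h
  obtain ⟨i, hi⟩ := h
  have h2 := odd_card_pairs_of_card_eq_one (one_le_blockSize lam) hi
    (by rw [sum_blockSize]; omega)
  have huniv : (Finset.univ : Finset (Fin (partList lam).length)).val =
      i ::ₘ (Finset.univ.erase i).val := by
    rw [← Finset.insert_val_of_notMem (Finset.notMem_erase i _),
      Finset.insert_erase (Finset.mem_univ i)]
  have hodd (k) : Odd (blockSize lam k) ↔ k = i := by
    rw [← Finset.mem_singleton, ← hi]; simp
  have hmap : (Finset.univ.erase i).val.map ((fun k => blockSize lam k / 2) - Pi.single i 1) =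
      (Finset.univ.erase i).val.map fun k => blockSize lam k / 2 := by
    refine Multiset.map_congr rfl fun k hk => ?_
    have hk' : k ≠ i := Finset.ne_of_mem_erase (Finset.mem_def.2 hk)
    simp [hk']
  refine ⟨(blockSize lam i / 2, (Finset.univ.erase i).val.map fun k => blockSize lam k / 2),
    ?_, ?_⟩
  · rw [oddConsEven, ← map_blockSize, huniv, Multiset.map_cons, Multiset.map_map]
    congr 1
    · have := Nat.odd_iff.1 ((hodd i).2 rfl)
      dsimp only
      omega
    · refine Multiset.map_congr rfl fun k hk => ?_
      have h3 : ¬ Odd (blockSize lam k) := fun h => Finset.ne_of_mem_erase (Finset.mem_def.2 hk) ((hodd k).1 h)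
      rw [Nat.not_odd_iff] at h3
      simp only [Function.comp]
      omega
  · rw [huniv, Multiset.map_cons, Multiset.map_cons, hmap] at h2
    simp only [Pi.sub_apply, Pi.single_eq_same] at h2
    rw [isChiral_iff_odd_card, ← h2, huniv]

lemma numChiralPermReps_eq_ncard {n : ℕ} (S : Set (Multiset ℕ))
    (hS : ∀ s ∈ S, 0 ∉ s ∧ s.sum = n)
    (h : ∀ lam : n.Partition, IsChiral (permRep lam) ↔ lam.parts ∈ S) :
    numChiralPermReps n = S.ncard := by
  rw [numChiralPermReps, ← Nat.card_coe_set_eq]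
  refine Nat.card_congr (Equiv.ofBijective (fun x => ⟨x.1.parts, (h x.1).1 x.2⟩) ⟨?_, ?_⟩)
  · intro x y hxy
    exact Subtype.ext (Nat.Partition.ext (congrArg Subtype.val hxy))
  · rintro ⟨s, hs⟩
    obtain ⟨h0, hsum⟩ := hS s hs
    let lam : n.Partition := ⟨s, fun {i} hi => Nat.pos_of_ne_zero fun hz => h0 (hz ▸ hi), hsum⟩
    exact ⟨⟨lam, (h lam).2 hs⟩, rfl⟩

lemma sum_of_mem_oddMarkedPartitions {r M : ℕ} {s : Multiset ℕ}
    (hs : s ∈ oddMarkedPartitions r M) : 0 ∉ s ∧ s.sum = 2 * M + r := by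
  rw [mem_oddMarkedPartitions] at hs
  have := sum_eq_two_mul_half_sum_add s
  exact ⟨hs.1, by omega⟩

/-- The number of odd parts is even here; `0` is never chiral and more than `3` is excluded, so only
`2` remains. -/
theorem numChiralPermReps_even (M : ℕ) :
    numChiralPermReps (2 * M + 2) = (oddMarkedPartitions 2 M).card := by
  rw [← Set.ncard_coe_finset]
  refine numChiralPermReps_eq_ncard _ (fun s hs => sum_of_mem_oddMarkedPartitions hs) fun lam => ?_
  rw [Finset.mem_coe, mem_oddMarkedPartitions]
  have h1 := sum_eq_two_mul_half_sum_add lam.parts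
  rw [lam.parts_sum] at h1
  rcases Nat.lt_or_ge (lam.parts.countP Odd) 2 with h | h
  · have h2 := not_isChiral_of_countP_eq_zero lam (by omega)
    constructor
    · intro h3
      exact absurd h3 h2
    · rintro ⟨-, h3, -⟩
      omega
  · rw [isChiral_iff_of_two_le_countP lam h]
    constructor
    · rintro ⟨h2, h3⟩
      exact ⟨zero_notMem_parts lam, by omega, by omega, h3⟩
    · rintro ⟨-, h2, -, h3⟩
      exact ⟨by omega, h3⟩

/-- The number of odd parts is `1` or `3`. In the first case chirality says that the pair (half of
the odd part, halves of the others) lies in exactly one of the two sets of pairs. -/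
theorem numChiralPermReps_odd (M : ℕ) :
    numChiralPermReps (2 * M + 3) = (oddMarkedPartitions 3 M).card +
      (symmDiff (markedPairs (M + 1)) (raisedPairs (M + 1))).ncard := by
  have hfin : (symmDiff (markedPairs (M + 1)) (raisedPairs (M + 1))).Finite :=
    (finite_markedPairs _).symmDiff (finite_raisedPairs_succ M)
  have hmem (x) : x ∈ symmDiff (markedPairs (M + 1)) (raisedPairs (M + 1)) ↔
      0 ∉ x.2 ∧ x.1 + x.2.sum = M + 1 ∧ ¬ (BitDisjoint (x.1 ::ₘ x.2) ↔
        (1 ≤ x.1 ∧ BitDisjoint ((x.1 - 1) ::ₘ x.2))) := by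
    simp only [Set.mem_symmDiff, markedPairs, raisedPairs, Set.mem_ofPred_eq]
    tauto
  have hdisj : Disjoint (oddMarkedPartitions 3 M : Set (Multiset ℕ))
      (oddConsEven '' symmDiff (markedPairs (M + 1)) (raisedPairs (M + 1))) := by
    rw [Set.disjoint_left]
    rintro _ hs ⟨x, -, rfl⟩
    rw [Finset.mem_coe, mem_oddMarkedPartitions, countP_odd_oddConsEven] at hs
    omega
  rw [← Set.ncard_coe_finset, ← Set.ncard_image_of_injective _ oddConsEven_injective,
    ← Set.ncard_union_eq hdisj (Finset.finite_toSet _) (hfin.image _)]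
  refine numChiralPermReps_eq_ncard (n := 2 * M + 1 + 2) _ ?_ fun lam => ?_
  · rintro s (hs | ⟨x, hx, rfl⟩)
    · exact sum_of_mem_oddMarkedPartitions hs
    · rw [hmem] at hx
      have h1 := sum_eq_two_mul_half_sum_add (oddConsEven x)
      rw [half_oddConsEven, Multiset.sum_cons, countP_odd_oddConsEven] at h1
      exact ⟨by rw [zero_mem_oddConsEven]; exact hx.1, by omega⟩
  · have h0 := zero_notMem_parts lam
    have h1 := sum_eq_two_mul_half_sum_add lam.parts
    rw [lam.parts_sum] at h1
    rw [Set.mem_union, Finset.mem_coe, mem_oddMarkedPartitions]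
    rcases Nat.lt_or_ge (lam.parts.countP Odd) 2 with h | h
    · obtain ⟨x, hx, hchi⟩ := isChiral_iff_of_countP_eq_one lam (by omega)
      rw [hx, zero_mem_oddConsEven] at h0
      rw [hx, half_oddConsEven, Multiset.sum_cons, countP_odd_oddConsEven] at h1
      rw [hchi, hx, oddConsEven_injective.mem_set_image, hmem, countP_odd_oddConsEven]
      constructor
      · intro h2
        exact Or.inr ⟨h0, by omega, h2⟩
      · rintro (h2 | h2)
        · omega
        · exact h2.2.2
    · rw [isChiral_iff_of_two_le_countP lam h]
      constructor
      · rintro ⟨h2, h3⟩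
        exact Or.inl ⟨h0, by omega, by omega, h3⟩
      · rintro (h2 | ⟨x, -, hx⟩)
        · exact ⟨by omega, h2.2.2.2⟩
        · rw [← hx, countP_odd_oddConsEven] at h
          omega

end

theorem theorem4 (n : ℕ) (hn : 3 ≤ n) :
    (Even n →
      (numChiralPermReps n : ℚ) =
        1 / 2 * ((Nat.bell (binaryOnes (n - 2) + 2) : ℚ)
          - (Nat.bell (binaryOnes (n - 2) + 1) : ℚ)
          + (Nat.bell (binaryOnes (n - 2)) : ℚ))) ∧
    (Odd n → ∀ k : ℕ, padicValNat 2 (n - 1) = k →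
      (numChiralPermReps n : ℚ) =
        1 / 6 * ((Nat.bell (binaryOnes (n - 3) + 3) : ℚ)
          - 3 * (Nat.bell (binaryOnes (n - 3) + 2) : ℚ)
          + 5 * (Nat.bell (binaryOnes (n - 3) + 1) : ℚ)
          + 2 * (Nat.bell (binaryOnes (n - 3)) : ℚ))
        + (Nat.bell (binaryOnes n + k - 2) : ℚ)
        + (Nat.bell (binaryOnes n) : ℚ)
        - 2 * (Nat.bell (binaryOnes n - 1) : ℚ)) := by
  constructor
  · intro he
    obtain ⟨M, rfl⟩ : ∃ M, n = 2 * M + 2 := by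
      obtain ⟨c, rfl⟩ := he
      exact ⟨c - 1, by omega⟩
    rw [numChiralPermReps_even, cast_card_oddMarkedPartitions_two, Nat.add_sub_cancel,
      binaryOnes_two_mul]
  · rintro ho k rfl
    obtain ⟨M, rfl⟩ : ∃ M, n = 2 * M + 3 := by
      obtain ⟨c, rfl⟩ := ho
      exact ⟨c - 1, by omega⟩
    have e1 : binaryOnes (2 * M + 3) = binaryOnes (M + 1) + 1 := by
      rw [show 2 * M + 3 = 2 * (M + 1) + 1 by ring, binaryOnes_two_mul_add_one]
    have e2 : padicValNat 2 (2 * M + 3 - 1) = padicValNat 2 (M + 1) + 1 := by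
      rw [show 2 * M + 3 - 1 = 2 * (M + 1) by omega, padicValNat.mul (by norm_num) (by omega),
        padicValNat.self (by norm_num), add_comm]
    have e3 := binaryOnes_succ_add_padicValNat M
    -- This index is the one counting `raisedPairs (M + 1)`, that is, marked pairs of sum `M`.
    have e4 : binaryOnes (2 * M + 3) + padicValNat 2 (2 * M + 3 - 1) - 2 = binaryOnes M + 1 := by
      omega
    have h1 := ncard_symmDiff_add (finite_markedPairs (M + 1)) (finite_raisedPairs_succ M)
    rw [ncard_markedPairs_inter_raisedPairs (by omega), ncard_markedPairs,
      ncard_raisedPairs_succ] at h1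
    have h2 : ((symmDiff (markedPairs (M + 1)) (raisedPairs (M + 1))).ncard : ℚ) +
        2 * Nat.bell (binaryOnes (M + 1)) =
        Nat.bell (binaryOnes (M + 1) + 1) + Nat.bell (binaryOnes M + 1) := by exact_mod_cast h1
    rw [numChiralPermReps_odd, e4, e1, Nat.add_sub_cancel, Nat.add_sub_cancel, binaryOnes_two_mul]
    push_cast
    rw [cast_card_oddMarkedPartitions_three]
    linarith
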